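/- **Pure types** are the closed expressions of the grammar $\tau ::= \mathbf 1 \mid \tau\times\tau \mid \tau\to\tau \mid \tau+\tau \mid \alpha \mid \mathrm{rec}\,\alpha.\tau$. A type $\tau$ is interpreted as a Scott domain $[\![\tau]\!]$: $[\![\mathbf 1]\!]=\{\bot<\top\}$; $[\![\sigma\times\tau]\!]$ is the Cartesian product; $[\![\sigma\to\tau]\!]$ is the set of Scott-continuous functions with the pointwise order; $[\![\sigma+\tau]\!]$ is the disjoint union of $[\![\sigma]\!]$ and $[\![\tau]\!]$ with a new least element added; and $[\![\mathrm{rec}\,\alpha.\tau]\!]$ is the colimit, in the category of embedding-projection pairs, of the chain $1\to F(1)\to F^2(1)\to\cdots$ for the functor $F=[\![\tau]\!](-)$, with its canonical isomorphism $\mathrm{unfold}:[\![\mathrm{rec}\,\alpha.\tau]\!]\to[\![\tau[\mathrm{rec}\,\alpha.\tau/\alpha]]\!]$. **Formulae.** Iteration terms are $t::=k\mid 0\mid t+1$, with $k$ an iteration variable. A fixpoint context $\Delta$ is a finite list $X_1:\sigma_1,\dots,X_n:\sigma_n$ of distinct fixpoint variables with pure types. For $s\in\{\pm,+,-\}$ (neutral,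 positive, negative; $-s$ fixes $\pm$ and exchanges $+$ and $-$), the sets $L^s(\Delta;\tau)$ are defined inductively as follows: - $\mathsf{True},\mathsf{False}\in L^s(\Delta;\tau)$, and $L^s(\Delta;\tau)$ is closed under $\wedge$ and $\vee$; - $\langle()\rangle\in L^s(\Delta;\mathbf 1)$; if $\varphi\in L^s(\Delta;\tau_i)$ then $\langle\pi_i\rangle\varphi\in L^s(\Delta;\tau_1\times\tau_2)$ and $\langle \mathrm{in}_i\rangle\varphi\in L^s(\Delta;\tau_1+\tau_2)$, for $i=1,2$; if $\varphi\in L^s(\Delta;\tau[\mathrm{rec}\,\alpha.\tau/\alpha])$ then $\langle\mathrm{fold}\rangle\varphi\in L^s(\Delta;\mathrm{rec}\,\alpha.\tau)$; - $X_i\in L^s(\Delta;\sigma_i)$; formulae may be weakened to larger fixpoint contexts; if $\varphi\in L^s(\Delta,X:\tau;\tau)$ then $(\mu^tX)\varphi,(\nu^tX)\varphi\in L^s(\Delta;\tau)$ for every iteration term $t$; - if $\varphi\in L^+(\Delta;\tau)$ and $k$ is positive in $\varphi$ then $(\exists k)\varphi\in L^+(\Delta;\tau)$; if $\varphi\in L^-(\Delta;\tau)$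 and $k$ is negative in $\varphi$ then $(\forall k)\varphi\in L^-(\Delta;\tau)$; - if $\psi\in L^{-s}(\,;\sigma)$ and $\varphi\in L^s(\,;\tau)$ (empty fixpoint contexts) then $(\psi\Rightarrow\varphi)\in L^s(\Delta;\sigma\to\tau)$. Here the relations "$k$ is positive in $\varphi$" and "$k$ is negative in $\varphi$" are the least ones such that: both hold if $k$ is not free in $\varphi$; both are preserved by $\wedge$, $\vee$ and the modalities $\langle\pi_i\rangle,\langle\mathrm{in}_i\rangle,\langle\mathrm{fold}\rangle$; $k$ is positive (negative) in $\psi\Rightarrow\varphi$ if it is negative (positive) in $\psi$ and positive (negative) in $\varphi$; positivity is preserved by $(\exists\ell)$ and $(\mu^tX)$, and also by $(\nu^tX)$ if $k$ does not occur in $t$; negativity is preserved by $(\forall\ell)$ and $(\nu^tX)$, and also by $(\mu^tX)$ if $k$ does not occur in $t$. **Semantics.** A valuation $\rho$ of $\Delta$ maps each $X_i$ to a subset of $[\![\sigma_i]\!]$ and each iteration variable to a natural number. The set $[\![\varphi]\!]\rho\subseteq[\![\tau]\!]$ is defined by: $\mathsf{True},\mathsf{False},\wedge,\vee$ are $[\![\tau]\!],\emptyset,\cap,\cup$;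 $[\![X_i]\!]\rho=\rho(X_i)$; $[\![\langle()\rangle]\!]\rho=\{\top\}$; $\langle\pi_i\rangle$ is the inverse image under the $i$-th projection, $\langle\mathrm{fold}\rangle$ the inverse image under $\mathrm{unfold}$, and $\langle\mathrm{in}_i\rangle$ the direct image under the $i$-th inclusion; $[\![\psi\Rightarrow\varphi]\!]\rho=\{f\mid\forall x\in[\![\psi]\!]\rho,\ f(x)\in[\![\varphi]\!]\rho\}$; $(\exists k)$ and $(\forall k)$ are the union and the intersection of $[\![\varphi]\!]\rho[m/k]$ over $m\in\mathbb N$; and $(\mu^tX)\varphi$, $(\nu^tX)\varphi$ are interpreted as the $[\![t]\!]\rho$-fold iterated substitutions of $\varphi$ for $X$ starting from $\mathsf{False}$, respectively $\mathsf{True}$, equivalently as the $[\![t]\!]\rho$-fold iterates of $S\mapsto[\![\varphi]\!]\rho[S/X]$ on $\emptyset$, respectively $[\![\tau]\!]$. **Proposition.** Let $\Delta$ be a fixpoint context, $\rho$ a valuation of $\Delta$, $(X:\sigma)\in\Delta$, $\tau$ a pure type, and consider, for a formula $\varphi$ of type $\tau$ over $\Delta$, the function $$\mathcal P([\![\sigma]\!])\to\mathcal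 P([\![\tau]\!]),\qquad S\mapsto[\![\varphi]\!]\rho[S/X].$$ 1. If $\varphi\in L^s(\Delta;\tau)$ for some $s\in\{\pm,+,-\}$, this function is monotone for inclusion. 2. If $\varphi\in L^+(\Delta;\tau)$, this function is Scott-continuous, i.e. it preserves unions of (nonempty) directed families. 3. If $\varphi\in L^-(\Delta;\tau)$, this function is Scott-cocontinuous, i.e. it preserves intersections of (nonempty) codirected families. -/

import Mathlib

open CategoryTheory

/-! ## Pure types (well-scoped de Bruijn syntax) -/

/-- `TyExpr n`: pure type expressions whose free type variables are among `n` given ones;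
`mu τ` is the recursive type binding the variable `0` of `τ`. -/
inductive TyExpr : ℕ → Type
  | unit {n : ℕ} : TyExpr n
  | prod {n : ℕ} (σ τ : TyExpr n) : TyExpr n
  | arrow {n : ℕ} (σ τ : TyExpr n) : TyExpr n
  | sum {n : ℕ} (σ τ : TyExpr n) : TyExpr n
  | var {n : ℕ} (i : Fin n) : TyExpr n
  | mu {n : ℕ} (τ : TyExpr (n + 1)) : TyExpr n

namespace TyExpr

/-- Renaming of type variables. -/
def ren : {n m : ℕ} → (Fin n → Fin m) → TyExpr n → TyExpr m
  | _, _, _, unit => unit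
  | _, _, r, prod σ τ => prod (σ.ren r) (τ.ren r)
  | _, _, r, arrow σ τ => arrow (σ.ren r) (τ.ren r)
  | _, _, r, sum σ τ => sum (σ.ren r) (τ.ren r)
  | _, _, r, var i => var (r i)
  | _, _, r, mu τ => mu (τ.ren (Fin.cases 0 fun i => (r i).succ))

/-- Lifting of a substitution under a binder. -/
def lift {n m : ℕ} (s : Fin n → TyExpr m) : Fin (n + 1) → TyExpr (m + 1) :=
  Fin.cases (var 0) fun i => (s i).ren Fin.succ

/-- Simultaneous capture-avoiding substitution. -/
def subst : {n m : ℕ} → (Fin n → TyExpr m) → TyExpr n → TyExpr m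
  | _, _, _, unit => unit
  | _, _, s, prod σ τ => prod (σ.subst s) (τ.subst s)
  | _, _, s, arrow σ τ => arrow (σ.subst s) (τ.subst s)
  | _, _, s, sum σ τ => sum (σ.subst s) (τ.subst s)
  | _, _, s, var i => s i
  | _, _, s, mu τ => mu (τ.subst (lift s))

/-- `τ.unroll` is `τ[mu τ / 0]`. -/
def unroll (τ : TyExpr 1) : TyExpr 0 := τ.subst fun _ => mu τ

end TyExpr

/-- Pure types are closed type expressions. -/
abbrev PureType : Type := TyExpr 0

/-! ## Cpo's and embedding-projection pairs -/

/-- A cpo: a partial order with a least element and suprema of all (nonempty) directed subsets.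

Scott domains (bounded-complete algebraic cpo's) form a full subcategory of the category of cpo's
and Scott-continuous functions, and this subcategory contains `1` and `{⊥ < ⊤}` and is closed under
products, function spaces, weak sums and colimits of `ω`-chains of embeddings, all computed as for
cpo's. The interpretation of pure types below uses only these operations, hence it takes values in
Scott domains and is the usual one. -/
structure Cpo : Type 1 where
  carrier : Type
  [po : PartialOrder carrier]
  exists_isBot : ∃ b : carrier, IsBot b
  exists_isLUB : ∀ d : Set carrier, d.Nonempty → DirectedOn (· ≤ ·) d → ∃ a, IsLUB d a

instance : CoeSort Cpo Type := ⟨Cpo.carrier⟩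

instance (X : Cpo) : PartialOrder X := X.po

/-- An embedding-projection pair from `X` to `Y`. -/
@[ext]
structure EP (X Y : Cpo) : Type where
  e : X → Y
  p : Y → X
  e_cont : ScottContinuous e
  p_cont : ScottContinuous p
  p_e : ∀ x, p (e x) = x
  e_p : ∀ y, e (p y) ≤ y

namespace EP

theorem gc {X Y : Cpo} (f : EP X Y) : GaloisConnection f.e f.p := fun x y =>
  ⟨fun h => by simpa [f.p_e] using f.p_cont.monotone h,
   fun h => (f.e_cont.monotone h).trans (f.e_p y)⟩

/-- A continuous map with a left adjoint section is the projection of an ep-pair. -/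
def ofGC {X Y : Cpo} (e : X → Y) (p : Y → X) (h : GaloisConnection e p)
    (hp : ScottContinuous p) (hpe : ∀ x, p (e x) = x) : EP X Y where
  e := e
  p := p
  e_cont := fun _ _ _ _ ha => h.isLUB_l_image ha
  p_cont := hp
  p_e := hpe
  e_p := h.l_u_le

theorem ext_p {X Y : Cpo} {f g : EP X Y} (h : ∀ y, f.p y = g.p y) : f = g := by
  have hp : f.p = g.p := funext h
  have he : f.e = g.e := funext fun _ => f.gc.l_unique g.gc h
  exact EP.ext he hp

def id (X : Cpo) : EP X X :=
  ofGC _root_.id _root_.id GaloisConnection.id ScottContinuous.id fun _ => rfl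

def comp {X Y Z : Cpo} (f : EP X Y) (g : EP Y Z) : EP X Z where
  e := g.e ∘ f.e
  p := f.p ∘ g.p
  e_cont := f.e_cont.comp g.e_cont
  p_cont := g.p_cont.comp f.p_cont
  p_e x := by simp [g.p_e, f.p_e]
  e_p y := (g.e_cont.monotone (f.e_p _)).trans (g.e_p y)

end EP

/-- The category of cpo's and embedding-projection pairs. -/
instance : Category.{0} Cpo where
  Hom := EP
  id := EP.id
  comp := EP.comp
  id_comp _ := rfl
  comp_id _ := rfl
  assoc _ _ _ := rfl

@[simp] theorem Cpo.comp_p {X Y Z : Cpo} (f : X ⟶ Y) (g : Y ⟶ Z) (z : Z) :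
    EP.p (f ≫ g) z = EP.p f (EP.p g z) := rfl

@[simp] theorem Cpo.comp_e {X Y Z : Cpo} (f : X ⟶ Y) (g : Y ⟶ Z) (x : X) :
    EP.e (f ≫ g) x = EP.e g (EP.e f x) := rfl

@[simp] theorem Cpo.id_p {X : Cpo} (x : X) : EP.p (𝟙 X) x = x := rfl

@[simp] theorem Cpo.id_e {X : Cpo} (x : X) : EP.e (𝟙 X) x = x := rfl

namespace Cpo

theorem directedOn_image_mono {α β : Type} [PartialOrder α] [PartialOrder β] {d : Set α}
    (hd : DirectedOn (· ≤ ·) d) {f : α → β} (hf : Monotone f) :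
    DirectedOn (· ≤ ·) (f '' d) :=
  DirectedOn.mono_comp (fun _ _ h => hf h) hd

theorem isLUB_image_image {α β γ δ : Type} [PartialOrder γ] {f : α → β} {g : β → γ}
    {k : α → δ} {h : δ → γ} {d : Set α} {a b : γ} (H : IsLUB (g '' (f '' d)) a)
    (e : ∀ x ∈ d, h (k x) = g (f x)) (hab : b = a) : IsLUB (h '' (k '' d)) b := by
  rw [Set.image_image] at H ⊢
  rw [hab, Set.image_congr e]
  exact H

/-- The one-point cpo. -/
def one : Cpo where
  carrier := PUnit
  exists_isBot := ⟨⟨⟩, fun _ => trivial⟩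
  exists_isLUB := fun _ _ _ => ⟨⟨⟩, fun _ _ => trivial, fun _ _ => trivial⟩

/-- The unique morphism from the one-point cpo. -/
noncomputable def init (X : Cpo) : one ⟶ X :=
  EP.ofGC (fun _ => X.exists_isBot.choose) (fun _ => PUnit.unit)
    (fun _ y => ⟨fun _ => trivial, fun _ => X.exists_isBot.choose_spec y⟩)
    (fun _ _ _ _ _ => ⟨fun _ _ => trivial, fun _ _ => trivial⟩) fun _ => rfl

theorem one_hom_ext {X : Cpo} (f g : one ⟶ X) : f = g := EP.ext_p fun _ => rfl

/-- The two-point cpo `{⊥ < ⊤}`, with `⊥ = false` and `⊤ = true`. -/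
def two : Cpo where
  carrier := Bool
  exists_isBot := ⟨⊥, isBot_bot⟩
  exists_isLUB := fun d _ _ => ⟨sSup d, isLUB_sSup d⟩

/-! ### Products -/

/-- The Cartesian product, with the component-wise order. -/
def prodObj (X Y : Cpo) : Cpo where
  carrier := X × Y
  exists_isBot := by
    obtain ⟨b, hb⟩ := X.exists_isBot
    obtain ⟨c, hc⟩ := Y.exists_isBot
    exact ⟨(b, c), fun x => ⟨hb _, hc _⟩⟩
  exists_isLUB := fun d hd hd' => by
    obtain ⟨a, ha⟩ := X.exists_isLUB (Prod.fst '' d) (hd.image _)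
      (directedOn_image_mono hd' monotone_fst)
    obtain ⟨b, hb⟩ := Y.exists_isLUB (Prod.snd '' d) (hd.image _)
      (directedOn_image_mono hd' monotone_snd)
    exact ⟨(a, b), isLUB_prod.2 ⟨ha, hb⟩⟩

theorem scottContinuous_prodMap {X X' Y Y' : Cpo} {f : X → X'} {g : Y → Y'}
    (hf : ScottContinuous f) (hg : ScottContinuous g) :
    ScottContinuous (α := prodObj X Y) (β := prodObj X' Y') (Prod.map f g) := by
  intro d hd hd' a ha
  obtain ⟨h1, h2⟩ := isLUB_prod.1 ha
  have k1 := hf (hd.image _)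
      (directedOn_image_mono hd' monotone_fst) h1
  have k2 := hg (hd.image _)
      (directedOn_image_mono hd' monotone_snd) h2
  refine isLUB_prod.2 ⟨?_, ?_⟩
  · exact isLUB_image_image k1 (fun _ _ => rfl) rfl
  · exact isLUB_image_image k2 (fun _ _ => rfl) rfl

/-- The product functor on ep-pairs. -/
def prodF : Cpo × Cpo ⥤ Cpo where
  obj P := prodObj P.1 P.2
  map {P Q} f := EP.ofGC (X := prodObj P.1 P.2) (Y := prodObj Q.1 Q.2)
    (Prod.map (EP.e f.1) (EP.e f.2)) (Prod.map (EP.p f.1) (EP.p f.2))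
    (fun x y => and_congr (EP.gc f.1 x.1 y.1) (EP.gc f.2 x.2 y.2))
    (scottContinuous_prodMap (EP.p_cont f.1) (EP.p_cont f.2))
    (fun x => Prod.ext (EP.p_e f.1 x.1) (EP.p_e f.2 x.2))
  map_id _ := EP.ext_p fun _ => rfl
  map_comp _ _ := EP.ext_p fun _ => rfl

/-! ### Function spaces -/

/-- Scott-continuous functions. -/
@[ext]
structure Fun (X Y : Cpo) : Type where
  toFun : X → Y
  cont : ScottContinuous toFun

instance (X Y : Cpo) : CoeFun (Fun X Y) fun _ => X → Y := ⟨Fun.toFun⟩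

instance (X Y : Cpo) : PartialOrder (Fun X Y) :=
  PartialOrder.lift Fun.toFun fun _ _ => Fun.ext

theorem isLUB_fun {X Y : Cpo} {F : Set (Fun X Y)} {g : Fun X Y}
    (h : ∀ x, IsLUB ((fun f : Fun X Y => f x) '' F) (g x)) : IsLUB F g :=
  ⟨fun f hf x => (h x).1 ⟨f, hf, rfl⟩,
   fun k hk x => (h x).2 (by rintro _ ⟨f, hf, rfl⟩; exact hk hf x)⟩

theorem directedOn_eval {X Y : Cpo} {F : Set (Fun X Y)} (hF : DirectedOn (· ≤ ·) F) (x : X) :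
    DirectedOn (· ≤ ·) ((fun f : Fun X Y => f x) '' F) :=
  directedOn_image_mono hF fun _ _ h => h x

/-- Directed suprema of Scott-continuous functions exist and are computed pointwise. -/
theorem exists_pointwise {X Y : Cpo} (F : Set (Fun X Y)) (hne : F.Nonempty)
    (hF : DirectedOn (· ≤ ·) F) :
    ∃ g : Fun X Y, ∀ x, IsLUB ((fun f : Fun X Y => f x) '' F) (g x) := by
  choose g hg using fun x => Y.exists_isLUB _ (hne.image _) (directedOn_eval hF x)
  refine ⟨⟨g, ?_⟩, hg⟩
  intro d hd hd' a ha
  constructor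
  · rintro _ ⟨x, hx, rfl⟩
    refine (hg x).2 ?_
    rintro _ ⟨f, hf, rfl⟩
    exact (f.cont.monotone (ha.1 hx)).trans ((hg a).1 ⟨f, hf, rfl⟩)
  · intro b hb
    refine (hg a).2 ?_
    rintro _ ⟨f, hf, rfl⟩
    refine (f.cont hd hd' ha).2 ?_
    rintro _ ⟨x, hx, rfl⟩
    exact ((hg x).1 ⟨f, hf, rfl⟩).trans (hb ⟨x, hx, rfl⟩)

theorem isLUB_fun_iff {X Y : Cpo} {F : Set (Fun X Y)} (hne : F.Nonempty)
    (hF : DirectedOn (· ≤ ·) F) {g : Fun X Y} :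
    IsLUB F g ↔ ∀ x, IsLUB ((fun f : Fun X Y => f x) '' F) (g x) := by
  refine ⟨fun h => ?_, isLUB_fun⟩
  obtain ⟨k, hk⟩ := exists_pointwise F hne hF
  rw [h.unique (isLUB_fun hk)]
  exact hk

/-- The cpo of Scott-continuous functions, with the pointwise order. -/
def funObj (X Y : Cpo) : Cpo where
  carrier := Fun X Y
  exists_isBot := by
    obtain ⟨b, hb⟩ := Y.exists_isBot
    exact ⟨⟨fun _ => b, ScottContinuous.const b⟩, fun f x => hb _⟩
  exists_isLUB := fun F hne hF => by
    obtain ⟨g, hg⟩ := exists_pointwise F hne hF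
    exact ⟨g, isLUB_fun hg⟩

/-- Pre- and postcomposition. -/
def funMap {X X' Y Y' : Cpo} (u : X' → X) (hu : ScottContinuous u) (v : Y → Y')
    (hv : ScottContinuous v) (f : Fun X Y) : Fun X' Y' :=
  ⟨v ∘ f ∘ u, (hu.comp f.cont).comp hv⟩

theorem scottContinuous_funMap {X X' Y Y' : Cpo} (u : X' → X) (hu : ScottContinuous u)
    (v : Y → Y') (hv : ScottContinuous v) :
    ScottContinuous (α := funObj X Y) (β := funObj X' Y') (funMap u hu v hv) := by
  intro F hne hF g hg
  refine isLUB_fun fun x => ?_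
  have h := hv (hne.image _) (directedOn_eval hF (u x)) ((isLUB_fun_iff hne hF).1 hg (u x))
  exact isLUB_image_image h (fun _ _ => rfl) rfl

/-- The function space functor on ep-pairs (covariant in both arguments). -/
def funF : Cpo × Cpo ⥤ Cpo where
  obj P := funObj P.1 P.2
  map {P Q} f := EP.ofGC (X := funObj P.1 P.2) (Y := funObj Q.1 Q.2)
    (funMap (EP.p f.1) (EP.p_cont f.1) (EP.e f.2) (EP.e_cont f.2))
    (funMap (EP.e f.1) (EP.e_cont f.1) (EP.p f.2) (EP.p_cont f.2))
    (fun g h => by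
      constructor
      · intro H x
        refine (EP.gc f.2 _ _).1 ?_
        have := H (EP.e f.1 x)
        simpa [funMap, EP.p_e] using this
      · intro H y
        refine (EP.gc f.2 _ _).2 ?_
        refine (H (EP.p f.1 y)).trans ?_
        exact (EP.p_cont f.2).monotone (h.cont.monotone (EP.e_p f.1 y)))
    (scottContinuous_funMap _ _ _ _)
    (fun g => Fun.ext (funext fun x => by simp [funMap, EP.p_e]))
  map_id _ := EP.ext_p fun _ => rfl
  map_comp _ _ := EP.ext_p fun _ => rfl

/-! ### Weak sums -/

/-- The disjoint union of `X` and `Y` with a new least element. -/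
abbrev Sum' (X Y : Cpo) : Type := WithBot (X ⊕ Y)

/-- The inclusion `i` identifies `Z` with a component of `X + Y`. -/
structure IsComponent {X Y Z : Cpo} (i : Z → Sum' X Y) : Prop where
  le_iff : ∀ a b, i a ≤ i b ↔ a ≤ b
  up : ∀ a z, i a ≤ z → ∃ b, z = i b
  down : ∀ z b, z ≤ i b → z = ⊥ ∨ ∃ a, z = i a

def inl {X Y : Cpo} (x : X) : Sum' X Y := ((Sum.inl x : X ⊕ Y) : WithBot (X ⊕ Y))

def inr {X Y : Cpo} (y : Y) : Sum' X Y := ((Sum.inr y : X ⊕ Y) : WithBot (X ⊕ Y))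

theorem sum_cases {X Y : Cpo} (z : Sum' X Y) : z = ⊥ ∨ (∃ x, z = inl x) ∨ ∃ y, z = inr y := by
  induction z using WithBot.recBotCoe with
  | bot => exact Or.inl rfl
  | coe z => rcases z with x | y
             · exact Or.inr (Or.inl ⟨x, rfl⟩)
             · exact Or.inr (Or.inr ⟨y, rfl⟩)

theorem isComponent_inl {X Y : Cpo} : IsComponent (inl : X → Sum' X Y) where
  le_iff a b := by simp [inl]
  up a z h := by
    rcases sum_cases z with rfl | ⟨x, rfl⟩ | ⟨y, rfl⟩
    · simp [inl] at h
    · exact ⟨x, rfl⟩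
    · simp [inl, inr] at h
  down z b h := by
    rcases sum_cases z with rfl | ⟨x, rfl⟩ | ⟨y, rfl⟩
    · exact Or.inl rfl
    · exact Or.inr ⟨x, rfl⟩
    · simp [inl, inr] at h

theorem isComponent_inr {X Y : Cpo} : IsComponent (inr : Y → Sum' X Y) where
  le_iff a b := by simp [inr]
  up a z h := by
    rcases sum_cases z with rfl | ⟨x, rfl⟩ | ⟨y, rfl⟩
    · simp [inr] at h
    · simp [inl, inr] at h
    · exact ⟨y, rfl⟩
  down z b h := by
    rcases sum_cases z with rfl | ⟨x, rfl⟩ | ⟨y, rfl⟩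
    · exact Or.inl rfl
    · simp [inl, inr] at h
    · exact Or.inr ⟨y, rfl⟩

namespace IsComponent

variable {X Y Z : Cpo} {i : Z → Sum' X Y}

theorem isLUB (hi : IsComponent i) {A : Set Z} {d : Set (Sum' X Y)} (hA : A.Nonempty)
    (h1 : ∀ a ∈ A, i a ∈ d) (h2 : ∀ z ∈ d, z = ⊥ ∨ ∃ a ∈ A, z = i a) {a : Z} (ha : IsLUB A a) :
    IsLUB d (i a) := by
  constructor
  · intro z hz
    rcases h2 z hz with rfl | ⟨b, hb, rfl⟩
    · exact bot_le
    · exact (hi.le_iff _ _).2 (ha.1 hb)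
  · intro z hz
    obtain ⟨b, hb⟩ := hA
    obtain ⟨c, rfl⟩ := hi.up b z (hz (h1 b hb))
    exact (hi.le_iff _ _).2 (ha.2 fun x hx => (hi.le_iff _ _).1 (hz (h1 x hx)))

theorem reduce (hi : IsComponent i) {d : Set (Sum' X Y)} (hd : DirectedOn (· ≤ ·) d)
    {b : Z} (hb : i b ∈ d) :
    ∃ A : Set Z, A.Nonempty ∧ DirectedOn (· ≤ ·) A ∧ (∀ a ∈ A, i a ∈ d) ∧
      ∀ z ∈ d, z = ⊥ ∨ ∃ a ∈ A, z = i a := by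
  refine ⟨{a | i a ∈ d}, ⟨b, hb⟩, ?_, fun a ha => ha, ?_⟩
  · intro x hx y hy
    obtain ⟨z, hz, hxz, hyz⟩ := hd _ hx _ hy
    obtain ⟨c, rfl⟩ := hi.up x z hxz
    exact ⟨c, hz, (hi.le_iff _ _).1 hxz, (hi.le_iff _ _).1 hyz⟩
  · intro z hz
    obtain ⟨w, hw, hzw, hbw⟩ := hd _ hz _ hb
    obtain ⟨c, rfl⟩ := hi.up b w hbw
    rcases hi.down z c hzw with h | ⟨a, rfl⟩
    · exact Or.inl h
    · exact Or.inr ⟨a, hz, rfl⟩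

end IsComponent

theorem sum_reduce {X Y : Cpo} (d : Set (Sum' X Y)) :
    (∀ z ∈ d, z = ⊥) ∨ (∃ x : X, inl x ∈ d) ∨ ∃ y : Y, inr y ∈ d := by
  by_cases h : ∀ z ∈ d, z = ⊥
  · exact Or.inl h
  · push Not at h
    obtain ⟨z, hz, hz'⟩ := h
    rcases sum_cases z with rfl | ⟨x, rfl⟩ | ⟨y, rfl⟩
    · exact absurd rfl hz'
    · exact Or.inr (Or.inl ⟨x, hz⟩)
    · exact Or.inr (Or.inr ⟨y, hz⟩)

theorem isLUB_bot_of_forall {X Y : Cpo} {d : Set (Sum' X Y)} (h : ∀ z ∈ d, z = ⊥) :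
    IsLUB d ⊥ := ⟨fun z hz => (h z hz).le, fun _ _ => bot_le⟩

/-- The weak coproduct `(X ⨿ Y)_⊥`. -/
def sumObj (X Y : Cpo) : Cpo where
  carrier := Sum' X Y
  exists_isBot := ⟨⊥, isBot_bot⟩
  exists_isLUB := fun d _ hd' => by
    rcases sum_reduce d with h | ⟨x, hx⟩ | ⟨y, hy⟩
    · exact ⟨_, isLUB_bot_of_forall h⟩
    · obtain ⟨A, hA, hAd, h1, h2⟩ := isComponent_inl.reduce hd' hx
      obtain ⟨a, ha⟩ := X.exists_isLUB A hA hAd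
      exact ⟨_, isComponent_inl.isLUB hA h1 h2 ha⟩
    · obtain ⟨A, hA, hAd, h1, h2⟩ := isComponent_inr.reduce hd' hy
      obtain ⟨a, ha⟩ := Y.exists_isLUB A hA hAd
      exact ⟨_, isComponent_inr.isLUB hA h1 h2 ha⟩

/-- The map `f + g`, preserving the least element. -/
def sumMap {X X' Y Y' : Cpo} (f : X → X') (g : Y → Y') : sumObj X Y → sumObj X' Y' :=
  WithBot.map (Sum.map f g)

theorem scottContinuous_sumMap {X X' Y Y' : Cpo} {f : X → X'} {g : Y → Y'}
    (hf : ScottContinuous f) (hg : ScottContinuous g) : ScottContinuous (sumMap f g) := by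
  intro d hd hd' s hs
  rcases sum_reduce d with h | ⟨x, hx⟩ | ⟨y, hy⟩
  · rw [hs.unique (isLUB_bot_of_forall h)]
    refine isLUB_bot_of_forall ?_
    rintro _ ⟨z, hz, rfl⟩
    rw [h z hz]
    rfl
  · obtain ⟨A, hA, hAd, h1, h2⟩ := isComponent_inl.reduce hd' hx
    obtain ⟨a, ha⟩ := X.exists_isLUB A hA hAd
    rw [hs.unique (isComponent_inl.isLUB hA h1 h2 ha)]
    refine isComponent_inl.isLUB (hA.image f) ?_ ?_ (hf hA hAd ha)
    · rintro _ ⟨b, hb, rfl⟩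
      exact ⟨inl b, h1 b hb, rfl⟩
    · rintro _ ⟨z, hz, rfl⟩
      rcases h2 z hz with rfl | ⟨b, hb, rfl⟩
      · exact Or.inl rfl
      · exact Or.inr ⟨f b, ⟨b, hb, rfl⟩, rfl⟩
  · obtain ⟨A, hA, hAd, h1, h2⟩ := isComponent_inr.reduce hd' hy
    obtain ⟨a, ha⟩ := Y.exists_isLUB A hA hAd
    rw [hs.unique (isComponent_inr.isLUB hA h1 h2 ha)]
    refine isComponent_inr.isLUB (hA.image g) ?_ ?_ (hg hA hAd ha)
    · rintro _ ⟨b, hb, rfl⟩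
      exact ⟨inr b, h1 b hb, rfl⟩
    · rintro _ ⟨z, hz, rfl⟩
      rcases h2 z hz with rfl | ⟨b, hb, rfl⟩
      · exact Or.inl rfl
      · exact Or.inr ⟨g b, ⟨b, hb, rfl⟩, rfl⟩

theorem gc_sumMap {X X' Y Y' : Cpo} (f : EP X X') (g : EP Y Y') :
    GaloisConnection (sumMap f.e g.e) (sumMap f.p g.p) := by
  intro x y
  rcases sum_cases x with rfl | ⟨x, rfl⟩ | ⟨x, rfl⟩
  · exact ⟨fun _ => bot_le (α := Sum' X Y), fun _ => bot_le (α := Sum' X' Y')⟩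
  · rcases sum_cases y with rfl | ⟨y, rfl⟩ | ⟨y, rfl⟩
    · exact ⟨fun h => absurd h (WithBot.not_coe_le_bot _),
        fun h => absurd h (WithBot.not_coe_le_bot _)⟩
    · exact (isComponent_inl.le_iff _ _).trans ((f.gc x y).trans (isComponent_inl.le_iff _ _).symm)
    · exact ⟨fun h => absurd (WithBot.coe_le_coe.1 h) Sum.not_inl_le_inr,
        fun h => absurd (WithBot.coe_le_coe.1 h) Sum.not_inl_le_inr⟩
  · rcases sum_cases y with rfl | ⟨y, rfl⟩ | ⟨y, rfl⟩
    · exact ⟨fun h => absurd h (WithBot.not_coe_le_bot _),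
        fun h => absurd h (WithBot.not_coe_le_bot _)⟩
    · exact ⟨fun h => absurd (WithBot.coe_le_coe.1 h) Sum.not_inr_le_inl,
        fun h => absurd (WithBot.coe_le_coe.1 h) Sum.not_inr_le_inl⟩
    · exact (isComponent_inr.le_iff _ _).trans ((g.gc x y).trans (isComponent_inr.le_iff _ _).symm)

/-- The weak coproduct functor on ep-pairs. -/
def sumF : Cpo × Cpo ⥤ Cpo where
  obj P := sumObj P.1 P.2
  map {P Q} f := EP.ofGC (X := sumObj P.1 P.2) (Y := sumObj Q.1 Q.2)
    (sumMap (EP.e f.1) (EP.e f.2)) (sumMap (EP.p f.1) (EP.p f.2))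
    (gc_sumMap f.1 f.2)
    (scottContinuous_sumMap (EP.p_cont f.1) (EP.p_cont f.2))
    (fun x => by
      rcases sum_cases x with rfl | ⟨x, rfl⟩ | ⟨x, rfl⟩
      · rfl
      · exact congrArg inl (EP.p_e f.1 x)
      · exact congrArg inr (EP.p_e f.2 x))
  map_id _ := EP.ext_p fun x => by
    rcases sum_cases x with rfl | ⟨x, rfl⟩ | ⟨x, rfl⟩ <;> rfl
  map_comp _ _ := EP.ext_p fun x => by
    rcases sum_cases x with rfl | ⟨x, rfl⟩ | ⟨x, rfl⟩ <;> rfl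

/-! ### Colimits of `ω`-chains of embeddings -/

/-- The points of the limit of the projections of an `ω`-chain of ep-pairs. -/
@[ext]
structure Thread (K : ℕ ⥤ Cpo) : Type where
  coord : ∀ n, K.obj n
  compat : ∀ {m n : ℕ} (f : m ⟶ n), EP.p (K.map f) (coord n) = coord m

instance (K : ℕ ⥤ Cpo) : PartialOrder (Thread K) :=
  PartialOrder.lift Thread.coord fun _ _ => Thread.ext

theorem isLUB_thread {K : ℕ ⥤ Cpo} {d : Set (Thread K)} {a : Thread K}
    (h : ∀ n, IsLUB ((fun x : Thread K => x.coord n) '' d) (a.coord n)) : IsLUB d a :=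
  ⟨fun x hx n => (h n).1 ⟨x, hx, rfl⟩,
   fun b hb n => (h n).2 (by rintro _ ⟨x, hx, rfl⟩; exact hb hx n)⟩

theorem directedOn_coord {K : ℕ ⥤ Cpo} {d : Set (Thread K)} (hd : DirectedOn (· ≤ ·) d) (n : ℕ) :
    DirectedOn (· ≤ ·) ((fun x : Thread K => x.coord n) '' d) :=
  directedOn_image_mono hd fun _ _ h => h n

theorem exists_lub_thread {K : ℕ ⥤ Cpo} (d : Set (Thread K)) (hne : d.Nonempty)
    (hd : DirectedOn (· ≤ ·) d) :
    ∃ a : Thread K, ∀ n, IsLUB ((fun x : Thread K => x.coord n) '' d) (a.coord n) := by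
  choose a ha using fun n => (K.obj n).exists_isLUB _ (hne.image _) (directedOn_coord hd n)
  refine ⟨⟨a, fun {m n} f => ?_⟩, ha⟩
  have h := EP.p_cont (K.map f) (hne.image _) (directedOn_coord hd n) (ha n)
  rw [Set.image_image, Set.image_congr fun x _ => x.compat f] at h
  exact h.unique (ha m)

theorem isLUB_thread_iff {K : ℕ ⥤ Cpo} {d : Set (Thread K)} (hne : d.Nonempty)
    (hd : DirectedOn (· ≤ ·) d) {a : Thread K} :
    IsLUB d a ↔ ∀ n, IsLUB ((fun x : Thread K => x.coord n) '' d) (a.coord n) := by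
  refine ⟨fun h => ?_, isLUB_thread⟩
  obtain ⟨b, hb⟩ := exists_lub_thread d hne hd
  rw [h.unique (isLUB_thread hb)]
  exact hb

theorem p_comp {K : ℕ ⥤ Cpo} {l m n : ℕ} (f : l ⟶ m) (g : m ⟶ n) (h : l ⟶ n) (x : K.obj n) :
    EP.p (K.map f) (EP.p (K.map g) x) = EP.p (K.map h) x := by
  rw [Subsingleton.elim h (f ≫ g), K.map_comp]
  rfl

theorem e_comp {K : ℕ ⥤ Cpo} {l m n : ℕ} (f : l ⟶ m) (g : m ⟶ n) (h : l ⟶ n) (x : K.obj l) :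
    EP.e (K.map g) (EP.e (K.map f) x) = EP.e (K.map h) x := by
  rw [Subsingleton.elim h (f ≫ g), K.map_comp]
  rfl

/-- The map `K n → K m` obtained by going up to `K (max n m)` and then down. -/
def transfer (K : ℕ ⥤ Cpo) (n m : ℕ) (x : K.obj n) : K.obj m :=
  EP.p (K.map (homOfLE (le_max_right n m))) (EP.e (K.map (homOfLE (le_max_left n m))) x)

theorem transfer_eq (K : ℕ ⥤ Cpo) {n m N : ℕ} (f : n ⟶ N) (g : m ⟶ N) (x : K.obj n) :
    EP.p (K.map g) (EP.e (K.map f) x) = transfer K n m x := by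
  have hN : max n m ≤ N := max_le (leOfHom f) (leOfHom g)
  rw [← e_comp (homOfLE (le_max_left n m)) (homOfLE hN) f,
    ← p_comp (homOfLE (le_max_right n m)) (homOfLE hN) g, EP.p_e]
  rfl

/-- The embedding of `K n` in the limit. -/
def embed (K : ℕ ⥤ Cpo) (n : ℕ) (x : K.obj n) : Thread K :=
  ⟨fun m => transfer K n m x, fun {m m'} f => by
    rw [← transfer_eq K (homOfLE (le_max_left n m')) (f ≫ homOfLE (le_max_right n m')),
      transfer, p_comp f]⟩

theorem embed_least (K : ℕ ⥤ Cpo) : IsBot (embed K 0 (K.obj 0).exists_isBot.choose) := by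
  intro x m
  rw [embed]
  dsimp only
  rw [← transfer_eq K (homOfLE (Nat.zero_le m)) (𝟙 m), K.map_id]
  exact (EP.gc _ _ _).2 ((K.obj 0).exists_isBot.choose_spec _)

/-- The limit of the projections, with the pointwise order. -/
def bilim (K : ℕ ⥤ Cpo) : Cpo where
  carrier := Thread K
  exists_isBot := ⟨_, embed_least K⟩
  exists_isLUB := fun d hne hd =>
    let ⟨a, ha⟩ := exists_lub_thread d hne hd
    ⟨a, isLUB_thread ha⟩

/-- The `n`-th component of the colimiting cocone: its projection is evaluation at `n`. -/
def leg (K : ℕ ⥤ Cpo) (n : ℕ) : K.obj n ⟶ bilim K :=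
  EP.ofGC (Y := bilim K) (embed K n) (fun x : Thread K => x.coord n)
    (fun y (x : Thread K) => by
      constructor
      · intro h
        have : transfer K n n y ≤ x.coord n := h n
        rwa [ ← transfer_eq K (𝟙 n) (𝟙 n), K.map_id] at this
      · intro h m
        rw [embed]
        have h1 : EP.e (K.map (homOfLE (le_max_left n m))) y ≤ x.coord (max n m) :=
          (EP.gc _ _ _).2 (by rw [x.compat]; exact h)
        have h2 := (EP.p_cont (K.map (homOfLE (le_max_right n m)))).monotone h1
        rwa [x.compat] at h2)
    (fun d hne hd a ha => (isLUB_thread_iff hne hd).1 ha n)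
    (fun y => by
      rw [embed]
      dsimp only
      rw [← transfer_eq K (𝟙 n) (𝟙 n), K.map_id]
      rfl)

def bilimCocone (K : ℕ ⥤ Cpo) : Limits.Cocone K where
  pt := bilim K
  ι := { app := leg K
         naturality := fun _ _ f => EP.ext_p fun x : Thread K => x.compat f }

theorem monotone_desc {K : ℕ ⥤ Cpo} (c : Limits.Cocone K) (x : Thread K) :
    Monotone fun n => EP.e (c.ι.app n) (x.coord n) := by
  intro m n h
  dsimp only
  rw [← c.w (homOfLE h), Cpo.comp_e, ← x.compat (homOfLE h)]
  exact (EP.e_cont (c.ι.app n)).monotone (EP.e_p _ _)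

theorem exists_desc {K : ℕ ⥤ Cpo} (c : Limits.Cocone K) (x : Thread K) :
    ∃ y, IsLUB (Set.range fun n => EP.e (c.ι.app n) (x.coord n)) y :=
  c.pt.exists_isLUB _ (Set.range_nonempty _)
    (directedOn_range.2 (monotone_desc c x).directed_le)

/-- The mediating morphism out of the colimit: `x ↦ ⨆ₙ eₙ (xₙ)`, with projection
`y ↦ (pₙ y)ₙ`. -/
noncomputable def bilimDesc {K : ℕ ⥤ Cpo} (c : Limits.Cocone K) : bilim K ⟶ c.pt :=
  EP.ofGC (X := bilim K) (fun x => (exists_desc c x).choose)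
    (fun y => (⟨fun n => EP.p (c.ι.app n) y, fun f => by
      rw [← Cpo.comp_p, c.w]⟩ : Thread K))
    (fun (x : Thread K) y => by
      refine (isLUB_le_iff (exists_desc c x).choose_spec).trans ?_
      constructor
      · intro h n
        exact (EP.gc _ _ _).1 (h ⟨n, rfl⟩)
      · rintro h _ ⟨n, rfl⟩
        exact (EP.gc _ _ _).2 (h n))
    (fun d hne hd a ha => isLUB_thread fun n => by
      have h := EP.p_cont (c.ι.app n) hne hd ha
      rw [← Set.image_id (_ '' d)] at h
      exact isLUB_image_image h (fun _ _ => rfl) rfl)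
    (fun (x : Thread K) => Thread.ext (funext fun m => by
      have h := EP.p_cont (c.ι.app m) (Set.range_nonempty _)
        (directedOn_range.2 (monotone_desc c x).directed_le) (exists_desc c x).choose_spec
      refine h.unique ?_
      constructor
      · rintro _ ⟨_, ⟨n, rfl⟩, rfl⟩
        have h1 := monotone_desc c x (le_max_left n m)
        refine ((EP.p_cont (c.ι.app m)).monotone h1).trans ?_
        dsimp only
        rw [← c.w (homOfLE (le_max_right n m)), Cpo.comp_p, EP.p_e, x.compat]
      · intro b hb
        have := hb ⟨_, ⟨m, rfl⟩, rfl⟩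
        simpa [EP.p_e] using this))

/-- The limit of the projections is the colimit of the chain of ep-pairs. -/
noncomputable def bilimIsColimit (K : ℕ ⥤ Cpo) : Limits.IsColimit (bilimCocone K) where
  desc c := bilimDesc c
  fac c n := EP.ext_p fun y => rfl
  uniq c m hm := EP.ext_p fun y => Thread.ext (funext fun n => by
    have h : EP.p ((bilimCocone K).ι.app n ≫ m) y = EP.p (c.ι.app n) y := by rw [hm n]
    exact h)

/-- The colimit functor on `ω`-chains of ep-pairs. -/
noncomputable def bilimF : (ℕ ⥤ Cpo) ⥤ Cpo where
  obj := bilim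
  map {K L} α := (bilimIsColimit K).map (bilimCocone L) α
  map_id K := (bilimIsColimit K).hom_ext fun n => by
    rw [Limits.IsColimit.ι_map]; rfl
  map_comp {K L M} α β := (bilimIsColimit K).hom_ext fun n => by
    refine (Limits.IsColimit.ι_map _ _ _ _).trans ?_
    have h1 := (bilimIsColimit K).ι_map (bilimCocone L) α n
    have h2 := (bilimIsColimit L).ι_map (bilimCocone M) β n
    change (α.app n ≫ β.app n) ≫ leg M n = leg K n ≫ _ ≫ _
    rw [Category.assoc]
    refine (congrArg (α.app n ≫ ·) h2.symm).trans ?_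
    exact (Category.assoc _ _ _).symm.trans ((congrArg (· ≫ _) h1.symm).trans
      (Category.assoc _ _ _))

/-! ### Fixpoints of endofunctors -/

/-- The iterates `F^n(1)`. -/
def iter (F : Cpo ⥤ Cpo) : ℕ → Cpo
  | 0 => one
  | n + 1 => F.obj (iter F n)

/-- The connecting morphisms `F^n(1) ⟶ F^(n+1)(1)`. -/
noncomputable def iterStep (F : Cpo ⥤ Cpo) : ∀ n, iter F n ⟶ iter F (n + 1)
  | 0 => init _
  | n + 1 => F.map (iterStep F n)

/-- The chain `1 ⟶ F(1) ⟶ F²(1) ⟶ ⋯`. -/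
noncomputable def chain (F : Cpo ⥤ Cpo) : ℕ ⥤ Cpo := Functor.ofSequence (iterStep F)

def iterMap {F G : Cpo ⥤ Cpo} (α : F ⟶ G) : ∀ n, iter F n ⟶ iter G n
  | 0 => 𝟙 _
  | n + 1 => α.app _ ≫ G.map (iterMap α n)

theorem iterMap_naturality {F G : Cpo ⥤ Cpo} (α : F ⟶ G) :
    ∀ n, iterStep F n ≫ iterMap α (n + 1) = iterMap α n ≫ iterStep G n
  | 0 => one_hom_ext _ _
  | n + 1 => by
    have ih := iterMap_naturality α n
    change F.map _ ≫ α.app _ ≫ G.map (iterMap α (n + 1)) =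
      (α.app _ ≫ G.map _) ≫ G.map (iterStep G n)
    rw [← Category.assoc, α.naturality, Category.assoc, ← G.map_comp, ih, Category.assoc,
      ← G.map_comp]

noncomputable def chainMap {F G : Cpo ⥤ Cpo} (α : F ⟶ G) : chain F ⟶ chain G :=
  NatTrans.ofSequence (F := chain F) (G := chain G) (iterMap α) fun n => by
    simp only [chain, Functor.ofSequence_map_homOfLE_succ]
    exact iterMap_naturality α n

noncomputable def chainF : (Cpo ⥤ Cpo) ⥤ (ℕ ⥤ Cpo) where
  obj := chain
  map := chainMap
  map_id F := by
    ext n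
    induction n with
    | zero => rfl
    | succ n ih =>
      change (𝟙 F : F ⟶ F).app _ ≫ F.map ((chainMap (𝟙 F)).app n) = 𝟙 _
      rw [ih]
      exact (Category.id_comp _).trans (F.map_id _)
  map_comp {F G H} α β := by
    ext n
    induction n with
    | zero => rfl
    | succ n ih =>
      change (α ≫ β).app _ ≫ H.map ((chainMap (α ≫ β)).app n) =
        (α.app _ ≫ G.map ((chainMap α).app n)) ≫ β.app _ ≫ H.map ((chainMap β).app n)
      rw [ih]
      change (α.app _ ≫ β.app _) ≫ H.map ((chainMap α).app n ≫ (chainMap β).app n) = _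
      rw [H.map_comp, Category.assoc, Category.assoc]
      congr 1
      rw [← Category.assoc, ← Category.assoc, ← β.naturality]

/-- `Fix F` is the colimit of `1 ⟶ F(1) ⟶ F²(1) ⟶ ⋯`, functorially in `F`. -/
noncomputable def fixF : (Cpo ⥤ Cpo) ⥤ Cpo := chainF ⋙ bilimF

/-- The cocone with components `F (γₙ) : F^(n+1)(1) ⟶ F (Fix F)`. -/
noncomputable def unfoldCocone (F : Cpo ⥤ Cpo) : Limits.Cocone (chain F) where
  pt := F.obj (fixF.obj F)
  ι := NatTrans.ofSequence (F := chain F)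
    (G := (Functor.const ℕ).obj (F.obj (fixF.obj F)))
    (fun n => match n with
      | 0 => init _
      | n + 1 => F.map (leg (chain F) n))
    (fun n => by
      simp only [chain, Functor.ofSequence_map_homOfLE_succ]
      cases n with
      | zero => exact one_hom_ext _ _
      | succ n =>
        have h := (bilimCocone (chain F)).w (homOfLE (Nat.le_succ n))
        simp only [chain, Functor.ofSequence_map_homOfLE_succ] at h
        change F.map (iterStep F n) ≫ F.map (leg (chain F) (n + 1)) =
          F.map (leg (chain F) n) ≫ 𝟙 _
        exact (F.map_comp _ _).symm.trans ((congrArg F.map h).trans (Category.comp_id _).symm))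

/-- The comparison morphism `Fix F ⟶ F (Fix F)` given by the universal property of the colimit
`Fix F` of the chain `F^n(1)`. It is an isomorphism whenever `F` preserves colimits of
`ω`-chains, as do all the functors interpreting type expressions. -/
noncomputable def unfoldEP (F : Cpo ⥤ Cpo) : fixF.obj F ⟶ F.obj (fixF.obj F) :=
  (bilimIsColimit (chain F)).desc (unfoldCocone F)

end Cpo

/-! ## Interpretation of pure types -/

namespace TyExpr

/-- The interpretation of a type expression, as a functor on ep-pairs, given functors interpreting
its free variables. Recursive types are interpreted by `Fix`. -/
noncomputable def sem : {n : ℕ} → TyExpr n → (D : Type 1) → [Category.{0} D] →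
    (Fin n → D ⥤ Cpo) → D ⥤ Cpo
  | _, unit, _, _, _ => (Functor.const _).obj Cpo.two
  | _, prod σ τ, D, _, φ => (σ.sem D φ).prod' (τ.sem D φ) ⋙ Cpo.prodF
  | _, arrow σ τ, D, _, φ => (σ.sem D φ).prod' (τ.sem D φ) ⋙ Cpo.funF
  | _, sum σ τ, D, _, φ => (σ.sem D φ).prod' (τ.sem D φ) ⋙ Cpo.sumF
  | _, var i, _, _, φ => φ i
  | _, mu τ, D, _, φ =>
    Functor.curry.obj (τ.sem (D × Cpo)
      (Fin.cases (CategoryTheory.Prod.snd D Cpo) fun i => CategoryTheory.Prod.fst D Cpo ⋙ φ i)) ⋙ Cpo.fixF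

theorem curry_comp {D E : Type 1} [Category.{0} D] [Category.{0} E] (H : E ⥤ D)
    (G : D × Cpo ⥤ Cpo) :
    Functor.curry.obj (H.prod (𝟭 Cpo) ⋙ G) = H ⋙ Functor.curry.obj G := by
  apply Functor.uncurry_obj_injective
  rw [Functor.uncurry_obj_curry_obj]
  conv_lhs => rw [← Functor.uncurry_obj_curry_obj G]
  rfl

theorem sem_comp {n : ℕ} (τ : TyExpr n) {D E : Type 1} [Category.{0} D] [Category.{0} E]
    (H : E ⥤ D) (φ : Fin n → D ⥤ Cpo) :
    τ.sem E (fun i => H ⋙ φ i) = H ⋙ τ.sem D φ := by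
  induction τ generalizing D E with
  | unit => rfl
  | prod σ τ h1 h2 => simp only [sem, h1, h2]; rfl
  | arrow σ τ h1 h2 => simp only [sem, h1, h2]; rfl
  | sum σ τ h1 h2 => simp only [sem, h1, h2]; rfl
  | var i => rfl
  | mu τ ih =>
    simp only [sem]
    rw [← Functor.assoc, ← curry_comp, ← ih]
    congr 3
    funext i
    refine Fin.cases ?_ (fun i => ?_) i <;> rfl

theorem sem_ren {n m : ℕ} (τ : TyExpr n) (r : Fin n → Fin m) {D : Type 1} [Category.{0} D]
    (φ : Fin m → D ⥤ Cpo) : (τ.ren r).sem D φ = τ.sem D fun i => φ (r i) := by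
  induction τ generalizing m D with
  | unit => rfl
  | prod σ τ h1 h2 => simp only [ren, sem, h1, h2]
  | arrow σ τ h1 h2 => simp only [ren, sem, h1, h2]
  | sum σ τ h1 h2 => simp only [ren, sem, h1, h2]
  | var i => rfl
  | mu τ ih =>
    simp only [ren, sem, ih]
    congr 3
    funext i
    refine Fin.cases ?_ (fun i => ?_) i <;> rfl

/-- Substitution is interpreted by composition. -/
theorem sem_subst {n m : ℕ} (τ : TyExpr n) (s : Fin n → TyExpr m) {D : Type 1} [Category.{0} D]
    (φ : Fin m → D ⥤ Cpo) : (τ.subst s).sem D φ = τ.sem D fun i => (s i).sem D φ := by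
  induction τ generalizing m D with
  | unit => rfl
  | prod σ τ h1 h2 => simp only [subst, sem, h1, h2]
  | arrow σ τ h1 h2 => simp only [subst, sem, h1, h2]
  | sum σ τ h1 h2 => simp only [subst, sem, h1, h2]
  | var i => rfl
  | mu τ ih =>
    simp only [subst, sem, ih]
    congr 3
    funext i
    refine Fin.cases ?_ (fun i => ?_) i
    · rfl
    · exact (sem_ren _ _ _).trans (sem_comp _ (CategoryTheory.Prod.fst D Cpo) φ)

/-- The functor `(CPO^ep)^n ⥤ CPO^ep` interpreting a type expression with `n` free variables. -/
noncomputable def interp {n : ℕ} (τ : TyExpr n) : (Fin n → Cpo) ⥤ Cpo :=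
  τ.sem (Fin n → Cpo) fun i => Pi.eval (fun _ => Cpo) i

/-- The endofunctor `X ↦ ⟦τ⟧(X)` of which `⟦mu τ⟧` is the fixpoint. -/
noncomputable def endo (τ : TyExpr 1) : Cpo ⥤ Cpo :=
  (Functor.curry.obj (τ.sem ((Fin 0 → Cpo) × Cpo)
    (Fin.cases (CategoryTheory.Prod.snd _ Cpo) fun i => CategoryTheory.Prod.fst _ Cpo ⋙ Pi.eval (fun _ => Cpo) i))).obj Fin.elim0

/-- The Scott domain interpreting a pure type. -/
noncomputable def dom (τ : PureType) : Cpo := τ.interp.obj Fin.elim0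

theorem dom_mu (τ : TyExpr 1) : dom (mu τ) = Cpo.fixF.obj τ.endo := rfl

theorem dom_unroll (τ : TyExpr 1) : dom τ.unroll = τ.endo.obj (dom (mu τ)) := by
  have h := sem_comp τ
    ((𝟭 (Fin 0 → Cpo)).prod' (mu τ).interp)
    (Fin.cases (CategoryTheory.Prod.snd _ Cpo) fun i =>
      CategoryTheory.Prod.fst _ Cpo ⋙ Pi.eval (fun _ => Cpo) i)
  have h' : (fun i : Fin 1 => ((𝟭 (Fin 0 → Cpo)).prod' (mu τ).interp) ⋙
      (Fin.cases (CategoryTheory.Prod.snd _ Cpo) fun i =>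
        CategoryTheory.Prod.fst _ Cpo ⋙ Pi.eval (fun _ => Cpo) i :
          Fin 1 → (Fin 0 → Cpo) × Cpo ⥤ Cpo) i) = fun _ => (mu τ).interp := by
    funext i
    refine Fin.cases ?_ (fun i => i.elim0) i
    rfl
  rw [h'] at h
  have hs := sem_subst τ (fun _ => mu τ) fun i : Fin 0 => Pi.eval (fun _ => Cpo) i
  exact congrArg (fun F : (Fin 0 → Cpo) ⥤ Cpo => F.obj Fin.elim0) (hs.trans h)

end TyExpr

namespace PureType

open TyExpr

/-- The set of points of the domain interpreting a pure type. -/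
abbrev Dom (τ : PureType) : Type := τ.dom

def fstMap {σ τ : PureType} (x : Dom (prod σ τ)) : Dom σ :=
  let x' : Dom σ × Dom τ := x
  x'.1

def sndMap {σ τ : PureType} (x : Dom (prod σ τ)) : Dom τ :=
  let x' : Dom σ × Dom τ := x
  x'.2

def inlMap {σ τ : PureType} (x : Dom σ) : Dom (sum σ τ) :=
  ((Sum.inl x : Dom σ ⊕ Dom τ) : WithBot (Dom σ ⊕ Dom τ))

def inrMap {σ τ : PureType} (y : Dom τ) : Dom (sum σ τ) :=
  ((Sum.inr y : Dom σ ⊕ Dom τ) : WithBot (Dom σ ⊕ Dom τ))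

/-- The element `⊤` of the two-point domain. -/
def top : Dom unit := true

/-- Application of an element of the function space. -/
def app {σ τ : PureType} (f : Dom (arrow σ τ)) (x : Dom σ) : Dom τ :=
  let f' : Cpo.Fun σ.dom τ.dom := f
  f' x

/-- The map `⟦mu τ⟧ → ⟦τ[mu τ]⟧`. -/
noncomputable def unfold {τ : TyExpr 1} (x : Dom (mu τ)) : Dom τ.unroll :=
  cast (congrArg Cpo.carrier (dom_unroll τ).symm) (EP.e (Cpo.unfoldEP τ.endo) x)

end PureType

/-! ## Formulae -/

/-- Iteration terms; iteration variables are de Bruijn indices. -/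
inductive ITerm : Type
  | var (k : ℕ) : ITerm
  | zero : ITerm
  | succ (t : ITerm) : ITerm

namespace ITerm

/-- The iteration variable `k` occurs in the term. -/
def Occurs (k : ℕ) : ITerm → Prop
  | var j => j = k
  | zero => False
  | succ t => t.Occurs k

def eval (δ : ℕ → ℕ) : ITerm → ℕ
  | var k => δ k
  | zero => 0
  | succ t => t.eval δ + 1

def ren (f : ℕ → ℕ) : ITerm → ITerm
  | var k => var (f k)
  | zero => zero
  | succ t => succ (t.ren f)

theorem eval_ren (f δ : ℕ → ℕ) (t : ITerm) : (t.ren f).eval δ = t.eval (δ ∘ f) := by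
  induction t with
  | var k => rfl
  | zero => rfl
  | succ t ih => simp [ren, eval, ih]

end ITerm

/-- A fixpoint context: `n` fixpoint variables with their types. -/
abbrev FCtx (n : ℕ) : Type := Fin n → PureType

/-- Typed formulae over a fixpoint context, before the polarity constraints.
`mu t φ` and `nu t φ` are the bounded iterations `(μ^t X)φ` and `(ν^t X)φ`; they bind the
fixpoint variable `0`, while `ex` and `all` bind the iteration variable `0`. -/
inductive Form : {n : ℕ} → FCtx n → PureType → Type
  | tt {n : ℕ} {Δ : FCtx n} {τ : PureType} : Form Δ τ
  | ff {n : ℕ} {Δ : FCtx n} {τ : PureType} : Form Δ τ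
  | and {n : ℕ} {Δ : FCtx n} {τ : PureType} (φ ψ : Form Δ τ) : Form Δ τ
  | or {n : ℕ} {Δ : FCtx n} {τ : PureType} (φ ψ : Form Δ τ) : Form Δ τ
  | triv {n : ℕ} {Δ : FCtx n} : Form Δ TyExpr.unit
  | fst {n : ℕ} {Δ : FCtx n} {σ τ : PureType} (φ : Form Δ σ) : Form Δ (TyExpr.prod σ τ)
  | snd {n : ℕ} {Δ : FCtx n} {σ τ : PureType} (φ : Form Δ τ) : Form Δ (TyExpr.prod σ τ)
  | inl {n : ℕ} {Δ : FCtx n} {σ τ : PureType} (φ : Form Δ σ) : Form Δ (TyExpr.sum σ τ)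
  | inr {n : ℕ} {Δ : FCtx n} {σ τ : PureType} (φ : Form Δ τ) : Form Δ (TyExpr.sum σ τ)
  | fold {n : ℕ} {Δ : FCtx n} {τ : TyExpr 1} (φ : Form Δ τ.unroll) : Form Δ (TyExpr.mu τ)
  | var {n : ℕ} {Δ : FCtx n} {τ : PureType} (i : Fin n) (h : Δ i = τ) : Form Δ τ
  | mu {n : ℕ} {Δ : FCtx n} {τ : PureType} (t : ITerm)
      (φ : Form (Fin.cons τ Δ : FCtx (n + 1)) τ) : Form Δ τ
  | nu {n : ℕ} {Δ : FCtx n} {τ : PureType} (t : ITerm)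
      (φ : Form (Fin.cons τ Δ : FCtx (n + 1)) τ) : Form Δ τ
  | ex {n : ℕ} {Δ : FCtx n} {τ : PureType} (φ : Form Δ τ) : Form Δ τ
  | all {n : ℕ} {Δ : FCtx n} {τ : PureType} (φ : Form Δ τ) : Form Δ τ
  | imp {n : ℕ} {Δ : FCtx n} {σ τ : PureType} (ψ : Form (Fin.elim0 : FCtx 0) σ)
      (φ : Form (Fin.elim0 : FCtx 0) τ) : Form Δ (TyExpr.arrow σ τ)

namespace Form

/-- The iteration variable `k` occurs free in the formula. -/
def Occurs : {n : ℕ} → {Δ : FCtx n} → {τ : PureType} → ℕ → Form Δ τ → Prop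
  | _, _, _, _, tt => False
  | _, _, _, _, ff => False
  | _, _, _, k, and φ ψ => φ.Occurs k ∨ ψ.Occurs k
  | _, _, _, k, or φ ψ => φ.Occurs k ∨ ψ.Occurs k
  | _, _, _, _, triv => False
  | _, _, _, k, fst φ => φ.Occurs k
  | _, _, _, k, snd φ => φ.Occurs k
  | _, _, _, k, inl φ => φ.Occurs k
  | _, _, _, k, inr φ => φ.Occurs k
  | _, _, _, k, fold φ => φ.Occurs k
  | _, _, _, _, var _ _ => False
  | _, _, _, k, mu t φ => t.Occurs k ∨ φ.Occurs k
  | _, _, _, k, nu t φ => t.Occurs k ∨ φ.Occurs k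
  | _, _, _, k, ex φ => φ.Occurs (k + 1)
  | _, _, _, k, all φ => φ.Occurs (k + 1)
  | _, _, _, k, imp ψ φ => ψ.Occurs k ∨ φ.Occurs k

mutual

/-- The iteration variable `k` is positive in the formula. -/
inductive Pos : {n : ℕ} → {Δ : FCtx n} → {τ : PureType} → ℕ → Form Δ τ → Prop
  | notFree {n : ℕ} {Δ : FCtx n} {τ : PureType} {k : ℕ} {φ : Form Δ τ} :
      ¬ φ.Occurs k → Pos k φ
  | and {n : ℕ} {Δ : FCtx n} {τ : PureType} {k : ℕ} {φ ψ : Form Δ τ} :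
      Pos k φ → Pos k ψ → Pos k (φ.and ψ)
  | or {n : ℕ} {Δ : FCtx n} {τ : PureType} {k : ℕ} {φ ψ : Form Δ τ} :
      Pos k φ → Pos k ψ → Pos k (φ.or ψ)
  | fst {n : ℕ} {Δ : FCtx n} {σ τ : PureType} {k : ℕ} {φ : Form Δ σ} :
      Pos k φ → Pos k (φ.fst : Form Δ (TyExpr.prod σ τ))
  | snd {n : ℕ} {Δ : FCtx n} {σ τ : PureType} {k : ℕ} {φ : Form Δ τ} :
      Pos k φ → Pos k (φ.snd : Form Δ (TyExpr.prod σ τ))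
  | inl {n : ℕ} {Δ : FCtx n} {σ τ : PureType} {k : ℕ} {φ : Form Δ σ} :
      Pos k φ → Pos k (φ.inl : Form Δ (TyExpr.sum σ τ))
  | inr {n : ℕ} {Δ : FCtx n} {σ τ : PureType} {k : ℕ} {φ : Form Δ τ} :
      Pos k φ → Pos k (φ.inr : Form Δ (TyExpr.sum σ τ))
  | fold {n : ℕ} {Δ : FCtx n} {τ : TyExpr 1} {k : ℕ} {φ : Form Δ τ.unroll} :
      Pos k φ → Pos k φ.fold
  | imp {n : ℕ} {Δ : FCtx n} {σ τ : PureType} {k : ℕ} {ψ : Form (Fin.elim0 : FCtx 0) σ}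
      {φ : Form (Fin.elim0 : FCtx 0) τ} :
      Neg k ψ → Pos k φ → Pos k (ψ.imp φ : Form Δ (TyExpr.arrow σ τ))
  | ex {n : ℕ} {Δ : FCtx n} {τ : PureType} {k : ℕ} {φ : Form Δ τ} :
      Pos (k + 1) φ → Pos k φ.ex
  | mu {n : ℕ} {Δ : FCtx n} {τ : PureType} {k : ℕ} {t : ITerm}
      {φ : Form (Fin.cons τ Δ : FCtx (n + 1)) τ} :
      Pos k φ → Pos k (φ.mu t)
  | nu {n : ℕ} {Δ : FCtx n} {τ : PureType} {k : ℕ} {t : ITerm}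
      {φ : Form (Fin.cons τ Δ : FCtx (n + 1)) τ} :
      Pos k φ → ¬ t.Occurs k → Pos k (φ.nu t)

/-- The iteration variable `k` is negative in the formula. -/
inductive Neg : {n : ℕ} → {Δ : FCtx n} → {τ : PureType} → ℕ → Form Δ τ → Prop
  | notFree {n : ℕ} {Δ : FCtx n} {τ : PureType} {k : ℕ} {φ : Form Δ τ} :
      ¬ φ.Occurs k → Neg k φ
  | and {n : ℕ} {Δ : FCtx n} {τ : PureType} {k : ℕ} {φ ψ : Form Δ τ} :
      Neg k φ → Neg k ψ → Neg k (φ.and ψ)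
  | or {n : ℕ} {Δ : FCtx n} {τ : PureType} {k : ℕ} {φ ψ : Form Δ τ} :
      Neg k φ → Neg k ψ → Neg k (φ.or ψ)
  | fst {n : ℕ} {Δ : FCtx n} {σ τ : PureType} {k : ℕ} {φ : Form Δ σ} :
      Neg k φ → Neg k (φ.fst : Form Δ (TyExpr.prod σ τ))
  | snd {n : ℕ} {Δ : FCtx n} {σ τ : PureType} {k : ℕ} {φ : Form Δ τ} :
      Neg k φ → Neg k (φ.snd : Form Δ (TyExpr.prod σ τ))
  | inl {n : ℕ} {Δ : FCtx n} {σ τ : PureType} {k : ℕ} {φ : Form Δ σ} :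
      Neg k φ → Neg k (φ.inl : Form Δ (TyExpr.sum σ τ))
  | inr {n : ℕ} {Δ : FCtx n} {σ τ : PureType} {k : ℕ} {φ : Form Δ τ} :
      Neg k φ → Neg k (φ.inr : Form Δ (TyExpr.sum σ τ))
  | fold {n : ℕ} {Δ : FCtx n} {τ : TyExpr 1} {k : ℕ} {φ : Form Δ τ.unroll} :
      Neg k φ → Neg k φ.fold
  | imp {n : ℕ} {Δ : FCtx n} {σ τ : PureType} {k : ℕ} {ψ : Form (Fin.elim0 : FCtx 0) σ}
      {φ : Form (Fin.elim0 : FCtx 0) τ} :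
      Pos k ψ → Neg k φ → Neg k (ψ.imp φ : Form Δ (TyExpr.arrow σ τ))
  | all {n : ℕ} {Δ : FCtx n} {τ : PureType} {k : ℕ} {φ : Form Δ τ} :
      Neg (k + 1) φ → Neg k φ.all
  | nu {n : ℕ} {Δ : FCtx n} {τ : PureType} {k : ℕ} {t : ITerm}
      {φ : Form (Fin.cons τ Δ : FCtx (n + 1)) τ} :
      Neg k φ → Neg k (φ.nu t)
  | mu {n : ℕ} {Δ : FCtx n} {τ : PureType} {k : ℕ} {t : ITerm}
      {φ : Form (Fin.cons τ Δ : FCtx (n + 1)) τ} :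
      Neg k φ → ¬ t.Occurs k → Neg k (φ.mu t)

end

end Form

/-- The polarities: neutral, positive, negative. -/
inductive Polarity : Type
  | neutral
  | pos
  | neg

/-- The opposite polarity. -/
def Polarity.opp : Polarity → Polarity
  | neutral => neutral
  | pos => neg
  | neg => pos

namespace Form

/-- `Lang s φ`: the formula `φ : Form Δ τ` belongs to the language `L^s(Δ; τ)`. The rule weakening
fixpoint contexts is absorbed in `var` and `imp`, which are available in all contexts. -/
inductive Lang : {n : ℕ} → {Δ : FCtx n} → {τ : PureType} → Polarity → Form Δ τ → Prop
  | tt {n : ℕ} {Δ : FCtx n} {τ : PureType} {s : Polarity} : Lang s (tt : Form Δ τ)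
  | ff {n : ℕ} {Δ : FCtx n} {τ : PureType} {s : Polarity} : Lang s (ff : Form Δ τ)
  | and {n : ℕ} {Δ : FCtx n} {τ : PureType} {s : Polarity} {φ ψ : Form Δ τ} :
      Lang s φ → Lang s ψ → Lang s (φ.and ψ)
  | or {n : ℕ} {Δ : FCtx n} {τ : PureType} {s : Polarity} {φ ψ : Form Δ τ} :
      Lang s φ → Lang s ψ → Lang s (φ.or ψ)
  | triv {n : ℕ} {Δ : FCtx n} {s : Polarity} : Lang s (triv : Form Δ TyExpr.unit)
  | fst {n : ℕ} {Δ : FCtx n} {σ τ : PureType} {s : Polarity} {φ : Form Δ σ} :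
      Lang s φ → Lang s (φ.fst : Form Δ (TyExpr.prod σ τ))
  | snd {n : ℕ} {Δ : FCtx n} {σ τ : PureType} {s : Polarity} {φ : Form Δ τ} :
      Lang s φ → Lang s (φ.snd : Form Δ (TyExpr.prod σ τ))
  | inl {n : ℕ} {Δ : FCtx n} {σ τ : PureType} {s : Polarity} {φ : Form Δ σ} :
      Lang s φ → Lang s (φ.inl : Form Δ (TyExpr.sum σ τ))
  | inr {n : ℕ} {Δ : FCtx n} {σ τ : PureType} {s : Polarity} {φ : Form Δ τ} :
      Lang s φ → Lang s (φ.inr : Form Δ (TyExpr.sum σ τ))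
  | fold {n : ℕ} {Δ : FCtx n} {τ : TyExpr 1} {s : Polarity} {φ : Form Δ τ.unroll} :
      Lang s φ → Lang s φ.fold
  | var {n : ℕ} {Δ : FCtx n} {τ : PureType} {s : Polarity} (i : Fin n) (h : Δ i = τ) :
      Lang s (var i h : Form Δ τ)
  | mu {n : ℕ} {Δ : FCtx n} {τ : PureType} {s : Polarity} (t : ITerm)
      {φ : Form (Fin.cons τ Δ : FCtx (n + 1)) τ} : Lang s φ → Lang s (φ.mu t)
  | nu {n : ℕ} {Δ : FCtx n} {τ : PureType} {s : Polarity} (t : ITerm)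
      {φ : Form (Fin.cons τ Δ : FCtx (n + 1)) τ} : Lang s φ → Lang s (φ.nu t)
  | ex {n : ℕ} {Δ : FCtx n} {τ : PureType} {φ : Form Δ τ} :
      Lang .pos φ → Pos 0 φ → Lang .pos φ.ex
  | all {n : ℕ} {Δ : FCtx n} {τ : PureType} {φ : Form Δ τ} :
      Lang .neg φ → Neg 0 φ → Lang .neg φ.all
  | imp {n : ℕ} {Δ : FCtx n} {σ τ : PureType} {s : Polarity}
      {ψ : Form (Fin.elim0 : FCtx 0) σ} {φ : Form (Fin.elim0 : FCtx 0) τ} :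
      Lang s.opp ψ → Lang s φ → Lang s (ψ.imp φ : Form Δ (TyExpr.arrow σ τ))

end Form

/-! ## Semantics of formulae -/

open PureType

/-- A valuation of a fixpoint context: sets for the fixpoint variables and natural numbers for
the iteration variables. -/
structure FVal {n : ℕ} (Δ : FCtx n) : Type where
  fp : ∀ i, Set (Dom (Δ i))
  it : ℕ → ℕ

namespace FVal

variable {n : ℕ} {Δ : FCtx n}

/-- `ρ[S / X]`. -/
def update (ρ : FVal Δ) (X : Fin n) (S : Set (Dom (Δ X))) : FVal Δ :=
  ⟨Function.update ρ.fp X S, ρ.it⟩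

/-- Extension of a valuation by a value for a newly bound fixpoint variable. -/
def push {τ : PureType} (ρ : FVal Δ) (S : Set (Dom τ)) :
    FVal (Fin.cons τ Δ : FCtx (n + 1)) :=
  ⟨Fin.cases S ρ.fp, ρ.it⟩

/-- Extension of a valuation by a value for a newly bound iteration variable. -/
def pushIt (ρ : FVal Δ) (m : ℕ) : FVal Δ :=
  ⟨ρ.fp, fun k => Nat.casesOn k m ρ.it⟩

/-- Restriction to the empty fixpoint context. -/
def closed (ρ : FVal Δ) : FVal (Fin.elim0 : FCtx 0) :=
  ⟨fun i => i.elim0, ρ.it⟩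

end FVal

namespace Form

/-- The interpretation of formulae (on all typed formulae, whatever their polarity). Bounded iteration iterates the function `S ↦ ⟦φ⟧ρ[S / X]`;
`eval_mu` and `eval_nu` below show that this is the interpretation of the iterated substitutions
`(X.φ)^m(False)` and `(X.φ)^m(True)`, where `m = ⟦t⟧ρ`. -/
noncomputable def eval : {n : ℕ} → {Δ : FCtx n} → {τ : PureType} → Form Δ τ → FVal Δ →
    Set (Dom τ)
  | _, _, _, tt, _ => Set.univ
  | _, _, _, ff, _ => ∅
  | _, _, _, and φ ψ, ρ => φ.eval ρ ∩ ψ.eval ρ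
  | _, _, _, or φ ψ, ρ => φ.eval ρ ∪ ψ.eval ρ
  | _, _, _, triv, _ => {top}
  | _, _, _, fst φ, ρ => {x | fstMap x ∈ φ.eval ρ}
  | _, _, _, snd φ, ρ => {x | sndMap x ∈ φ.eval ρ}
  | _, _, _, inl φ, ρ => inlMap '' φ.eval ρ
  | _, _, _, inr φ, ρ => inrMap '' φ.eval ρ
  | _, _, _, fold φ, ρ => {x | unfold x ∈ φ.eval ρ}
  | _, _, _, var i h, ρ => h ▸ ρ.fp i
  | _, _, _, mu t φ, ρ => (fun S => φ.eval (ρ.push S))^[t.eval ρ.it] ∅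
  | _, _, _, nu t φ, ρ => (fun S => φ.eval (ρ.push S))^[t.eval ρ.it] Set.univ
  | _, _, _, ex φ, ρ => ⋃ m : ℕ, φ.eval (ρ.pushIt m)
  | _, _, _, all φ, ρ => ⋂ m : ℕ, φ.eval (ρ.pushIt m)
  | _, _, _, imp ψ φ, ρ => {f | ∀ x ∈ ψ.eval ρ.closed, app f x ∈ φ.eval ρ.closed}

/-! ### Substitution of formulae, and the syntactic description of bounded iteration -/

/-- Renaming of fixpoint variables. -/
def ren : {n m : ℕ} → {Δ : FCtx n} → {Γ : FCtx m} → {τ : PureType} → (r : Fin n → Fin m) →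
    (∀ i, Γ (r i) = Δ i) → Form Δ τ → Form Γ τ
  | _, _, _, _, _, _, _, tt => tt
  | _, _, _, _, _, _, _, ff => ff
  | _, _, _, _, _, r, hr, and φ ψ => and (φ.ren r hr) (ψ.ren r hr)
  | _, _, _, _, _, r, hr, or φ ψ => or (φ.ren r hr) (ψ.ren r hr)
  | _, _, _, _, _, _, _, triv => triv
  | _, _, _, _, _, r, hr, fst φ => fst (φ.ren r hr)
  | _, _, _, _, _, r, hr, snd φ => snd (φ.ren r hr)
  | _, _, _, _, _, r, hr, inl φ => inl (φ.ren r hr)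
  | _, _, _, _, _, r, hr, inr φ => inr (φ.ren r hr)
  | _, _, _, _, _, r, hr, fold φ => fold (φ.ren r hr)
  | _, _, _, _, _, r, hr, var i h => var (r i) ((hr i).trans h)
  | _, _, _, _, _, r, hr, mu t φ =>
    mu t (φ.ren (Fin.cases 0 fun i => (r i).succ) (Fin.cases rfl hr))
  | _, _, _, _, _, r, hr, nu t φ =>
    nu t (φ.ren (Fin.cases 0 fun i => (r i).succ) (Fin.cases rfl hr))
  | _, _, _, _, _, r, hr, ex φ => ex (φ.ren r hr)
  | _, _, _, _, _, r, hr, all φ => all (φ.ren r hr)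
  | _, _, _, _, _, _, _, imp ψ φ => imp ψ φ

/-- Renaming of iteration variables. -/
def renIt : {n : ℕ} → {Δ : FCtx n} → {τ : PureType} → (ℕ → ℕ) → Form Δ τ → Form Δ τ
  | _, _, _, _, tt => tt
  | _, _, _, _, ff => ff
  | _, _, _, f, and φ ψ => and (φ.renIt f) (ψ.renIt f)
  | _, _, _, f, or φ ψ => or (φ.renIt f) (ψ.renIt f)
  | _, _, _, _, triv => triv
  | _, _, _, f, fst φ => fst (φ.renIt f)
  | _, _, _, f, snd φ => snd (φ.renIt f)
  | _, _, _, f, inl φ => inl (φ.renIt f)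
  | _, _, _, f, inr φ => inr (φ.renIt f)
  | _, _, _, f, fold φ => fold (φ.renIt f)
  | _, _, _, _, var i h => var i h
  | _, _, _, f, mu t φ => mu (t.ren f) (φ.renIt f)
  | _, _, _, f, nu t φ => nu (t.ren f) (φ.renIt f)
  | _, _, _, f, ex φ => ex (φ.renIt fun k => Nat.casesOn k 0 fun j => f j + 1)
  | _, _, _, f, all φ => all (φ.renIt fun k => Nat.casesOn k 0 fun j => f j + 1)
  | _, _, _, f, imp ψ φ => imp (ψ.renIt f) (φ.renIt f)

/-- Lifting of a substitution under a binder for a fixpoint variable. -/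
def lift {n m : ℕ} {Δ : FCtx n} {Γ : FCtx m} (τ : PureType) (s : ∀ i, Form Γ (Δ i)) :
    ∀ i, Form (Fin.cons τ Γ : FCtx (m + 1)) ((Fin.cons τ Δ : FCtx (n + 1)) i) :=
  Fin.cases (var 0 rfl) fun i => (s i).ren Fin.succ fun _ => rfl

/-- Simultaneous capture-avoiding substitution for the fixpoint variables. -/
def subst : {n m : ℕ} → {Δ : FCtx n} → {Γ : FCtx m} → {τ : PureType} →
    (∀ i, Form Γ (Δ i)) → Form Δ τ → Form Γ τ
  | _, _, _, _, _, _, tt => tt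
  | _, _, _, _, _, _, ff => ff
  | _, _, _, _, _, s, and φ ψ => and (φ.subst s) (ψ.subst s)
  | _, _, _, _, _, s, or φ ψ => or (φ.subst s) (ψ.subst s)
  | _, _, _, _, _, _, triv => triv
  | _, _, _, _, _, s, fst φ => fst (φ.subst s)
  | _, _, _, _, _, s, snd φ => snd (φ.subst s)
  | _, _, _, _, _, s, inl φ => inl (φ.subst s)
  | _, _, _, _, _, s, inr φ => inr (φ.subst s)
  | _, _, _, _, _, s, fold φ => fold (φ.subst s)
  | _, _, _, _, _, s, var i h => h ▸ s i
  | _, _, _, _, τ, s, mu t φ => mu t (φ.subst (lift τ s))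
  | _, _, _, _, τ, s, nu t φ => nu t (φ.subst (lift τ s))
  | _, _, _, _, _, s, ex φ => ex (φ.subst fun i => (s i).renIt Nat.succ)
  | _, _, _, _, _, s, all φ => all (φ.subst fun i => (s i).renIt Nat.succ)
  | _, _, _, _, _, _, imp ψ φ => imp ψ φ

/-- `φ[ψ / X]`, where `X` is the variable `0`. -/
def inst {n : ℕ} {Δ : FCtx n} {σ τ : PureType} (φ : Form (Fin.cons σ Δ : FCtx (n + 1)) τ)
    (ψ : Form Δ σ) : Form Δ τ :=
  φ.subst (Fin.cases ψ fun i => var i rfl)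

/-- The formula `(X.φ)^m(ψ)`. -/
def iter {n : ℕ} {Δ : FCtx n} {τ : PureType} (φ : Form (Fin.cons τ Δ : FCtx (n + 1)) τ)
    (ψ : Form Δ τ) : ℕ → Form Δ τ
  | 0 => ψ
  | m + 1 => φ.inst (φ.iter ψ m)

theorem eval_ren {n m : ℕ} {Δ : FCtx n} {Γ : FCtx m} {τ : PureType} (r : Fin n → Fin m)
    (hr : ∀ i, Γ (r i) = Δ i) (φ : Form Δ τ) (ρ : FVal Γ) :
    (φ.ren r hr).eval ρ = φ.eval ⟨fun i => hr i ▸ ρ.fp (r i), ρ.it⟩ := by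
  induction φ generalizing m with
  | tt => rfl
  | ff => rfl
  | and φ ψ h1 h2 => simp only [ren, eval, h1, h2]
  | or φ ψ h1 h2 => simp only [ren, eval, h1, h2]
  | triv => rfl
  | fst φ ih => simp only [ren, eval, ih]
  | snd φ ih => simp only [ren, eval, ih]
  | inl φ ih => simp only [ren, eval, ih]
  | inr φ ih => simp only [ren, eval, ih]
  | fold φ ih => simp only [ren, eval, ih]
  | var i h => subst h; simp only [ren, eval]
  | mu t φ ih =>
    simp only [ren, eval, ih]
    congr 1
    funext S
    congr 2
    funext i
    refine Fin.cases ?_ (fun i => ?_) i <;> rfl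
  | nu t φ ih =>
    simp only [ren, eval, ih]
    congr 1
    funext S
    congr 2
    funext i
    refine Fin.cases ?_ (fun i => ?_) i <;> rfl
  | ex φ ih => simp only [ren, eval, ih]; rfl
  | all φ ih => simp only [ren, eval, ih]; rfl
  | imp ψ φ h1 h2 => rfl

theorem eval_renIt {n : ℕ} {Δ : FCtx n} {τ : PureType} (f : ℕ → ℕ) (φ : Form Δ τ) (ρ : FVal Δ) :
    (φ.renIt f).eval ρ = φ.eval ⟨ρ.fp, ρ.it ∘ f⟩ := by
  induction φ generalizing f with
  | tt => rfl
  | ff => rfl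
  | and φ ψ h1 h2 => simp only [renIt, eval, h1, h2]
  | or φ ψ h1 h2 => simp only [renIt, eval, h1, h2]
  | triv => rfl
  | fst φ ih => simp only [renIt, eval, ih]
  | snd φ ih => simp only [renIt, eval, ih]
  | inl φ ih => simp only [renIt, eval, ih]
  | inr φ ih => simp only [renIt, eval, ih]
  | fold φ ih => simp only [renIt, eval, ih]
  | var i h => rfl
  | mu t φ ih => simp only [renIt, eval, ih, ITerm.eval_ren]; rfl
  | nu t φ ih => simp only [renIt, eval, ih, ITerm.eval_ren]; rfl
  | ex φ ih =>
    simp only [renIt, eval, ih]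
    refine Set.iUnion_congr fun m => congrArg φ.eval (congrArg (FVal.mk ρ.fp) ?_)
    funext k
    cases k <;> rfl
  | all φ ih =>
    simp only [renIt, eval, ih]
    refine Set.iInter_congr fun m => congrArg φ.eval (congrArg (FVal.mk ρ.fp) ?_)
    funext k
    cases k <;> rfl
  | imp ψ φ h1 h2 => simp only [renIt, eval, h1, h2]; rfl

theorem eval_subst {n m : ℕ} {Δ : FCtx n} {Γ : FCtx m} {τ : PureType}
    (s : ∀ i, Form Γ (Δ i)) (φ : Form Δ τ) (ρ : FVal Γ) :
    (φ.subst s).eval ρ = φ.eval ⟨fun i => (s i).eval ρ, ρ.it⟩ := by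
  induction φ generalizing m with
  | tt => rfl
  | ff => rfl
  | and φ ψ h1 h2 => simp only [subst, eval, h1, h2]
  | or φ ψ h1 h2 => simp only [subst, eval, h1, h2]
  | triv => rfl
  | fst φ ih => simp only [subst, eval, ih]
  | snd φ ih => simp only [subst, eval, ih]
  | inl φ ih => simp only [subst, eval, ih]
  | inr φ ih => simp only [subst, eval, ih]
  | fold φ ih => simp only [subst, eval, ih]
  | var i h => subst h; rfl
  | mu t φ ih =>
    simp only [subst, eval, ih]
    congr 1
    funext S
    congr 2
    funext i
    refine Fin.cases rfl (fun i => ?_) i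
    exact eval_ren _ _ _ _
  | nu t φ ih =>
    simp only [subst, eval, ih]
    congr 1
    funext S
    congr 2
    funext i
    refine Fin.cases rfl (fun i => ?_) i
    exact eval_ren _ _ _ _
  | ex φ ih => simp only [subst, eval, ih, eval_renIt]; rfl
  | all φ ih => simp only [subst, eval, ih, eval_renIt]; rfl
  | imp ψ φ h1 h2 => rfl

theorem eval_iter {n : ℕ} {Δ : FCtx n} {τ : PureType}
    (φ : Form (Fin.cons τ Δ : FCtx (n + 1)) τ) (ψ : Form Δ τ) (ρ : FVal Δ) (m : ℕ) :
    (φ.iter ψ m).eval ρ = (fun S => φ.eval (ρ.push S))^[m] (ψ.eval ρ) := by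
  induction m with
  | zero => rfl
  | succ m ih =>
    rw [Function.iterate_succ_apply', ← ih, iter, inst, eval_subst]
    congr 2
    funext i
    refine Fin.cases ?_ (fun i => ?_) i <;> rfl

/-- `⟦(μ^t X)φ⟧ρ = ⟦(X.φ)^(⟦t⟧ρ)(False)⟧ρ`. -/
theorem eval_mu {n : ℕ} {Δ : FCtx n} {τ : PureType} (t : ITerm)
    (φ : Form (Fin.cons τ Δ : FCtx (n + 1)) τ) (ρ : FVal Δ) :
    (φ.mu t).eval ρ = (φ.iter ff (t.eval ρ.it)).eval ρ := by
  simp only [eval_iter, eval]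

/-- `⟦(ν^t X)φ⟧ρ = ⟦(X.φ)^(⟦t⟧ρ)(True)⟧ρ`. -/
theorem eval_nu {n : ℕ} {Δ : FCtx n} {τ : PureType} (t : ITerm)
    (φ : Form (Fin.cons τ Δ : FCtx (n + 1)) τ) (ρ : FVal Δ) :
    (φ.nu t).eval ρ = (φ.iter tt (t.eval ρ.it)).eval ρ := by
  simp only [eval_iter, eval]

/-- The function `S ↦ ⟦φ⟧ρ[S / X]`. -/
noncomputable def evalFun {n : ℕ} {Δ : FCtx n} {τ : PureType} (φ : Form Δ τ) (ρ : FVal Δ)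
    (X : Fin n) : Set (Dom (Δ X)) → Set (Dom τ) :=
  fun S => φ.eval (ρ.update X S)

end Form

/-- Scott-cocontinuity: preservation of infima of (nonempty) codirected sets. For functions
between powersets, these are the codirected intersections. -/
def ScottCocontinuous {α β : Type} [Preorder α] [Preorder β] (f : α → β) : Prop :=
  ∀ ⦃d : Set α⦄, d.Nonempty → DirectedOn (· ≥ ·) d → ∀ ⦃a⦄, IsGLB d a → IsGLB (f '' d) (f a)

-- A fixpoint variable never occurs under an implication, since both sides of `imp` live in the
-- empty fixpoint context. Every remaining constructor is monotone in the fixpoint variables, so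
-- monotonicity (`eval_mono`) holds by structural induction, whatever the polarity.
--
-- For continuity, each constructor must commute with directed unions. Inverse images, direct
-- images, disjunction and `ex` commute with all of the unions involved; conjunction does so because
-- the family is directed; an implication is constant in the fixpoint variables. The only connective
-- that could fail is `all`, an infinite intersection, and it is absent from positive formulae.
-- Cocontinuity is dual: disjunction now relies on codirectedness, the direct images on injectivity
-- of the inclusions, and the excluded connective is `ex`.
--
-- Bounded iterations cause no trouble in either polarity, because the number of steps is fixed by
-- the values of the iteration variables, which do not move along the family. They do dictate the
-- form of the induction: inside `mu` or `nu` the bound variable takes as values the successive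
-- iterates, which vary together with the outer valuation. The claim is therefore proved for
-- families of valuations in which all fixpoint variables vary at once (`Lang.eval_iUnion`,
-- `Lang.eval_iInter`), with `iterate_iUnion` and `iterate_iInter` treating the iterations. The
-- one-variable statement is the case where the other components are constant.

-- Order, unions and intersections of valuations.

namespace FVal

variable {n : ℕ} {Δ : FCtx n}

theorem push_fp_mono {τ : PureType} {ρ ρ' : FVal Δ} {S S' : Set (Dom τ)} (hρ : ρ.fp ≤ ρ'.fp)
    (hS : S ⊆ S') : (ρ.push S).fp ≤ (ρ'.push S').fp :=
  fun i => Fin.cases hS hρ i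

theorem push_mk_fp_mono {τ : PureType} {fp fp' : ∀ X, Set (Dom (Δ X))} (δ : ℕ → ℕ)
    (h : fp ≤ fp') {S S' : Set (Dom τ)} (hS : S ⊆ S') :
    (push (Δ := Δ) ⟨fp, δ⟩ S).fp ≤ (push (Δ := Δ) ⟨fp', δ⟩ S').fp :=
  push_fp_mono h hS

theorem update_fp_mono (ρ : FVal Δ) (X : Fin n) {S S' : Set (Dom (Δ X))} (h : S ⊆ S') :
    (ρ.update X S).fp ≤ (ρ.update X S').fp :=
  update_le_update_iff.2 ⟨h, fun _ _ => le_rfl⟩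

/-- This turns a family of sets for one variable into a family of whole valuations, the shape
required by `Lang.eval_iUnion`. At the variables other than `X` the family is constant, so the index
type must be nonempty for its union to be that constant. -/
theorem update_iUnion {ι : Type} [Nonempty ι] (ρ : FVal Δ) (X : Fin n)
    (S : ι → Set (Dom (Δ X))) :
    ρ.update X (⋃ i, S i) = ⟨fun Y => ⋃ i, (ρ.update X (S i)).fp Y, ρ.it⟩ := by
  refine congrArg (FVal.mk · ρ.it) (funext fun Y => ?_)
  by_cases h : Y = X
  · subst h
    simp [update]
  · simp [update, h, Set.iUnion_const]

theorem update_iInter {ι : Type} [Nonempty ι] (ρ : FVal Δ) (X : Fin n)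
    (S : ι → Set (Dom (Δ X))) :
    ρ.update X (⋂ i, S i) = ⟨fun Y => ⋂ i, (ρ.update X (S i)).fp Y, ρ.it⟩ := by
  refine congrArg (FVal.mk · ρ.it) (funext fun Y => ?_)
  by_cases h : Y = X
  · subst h
    simp [update]
  · simp [update, h, Set.iInter_const]

/-- Used when passing under a binder: the union over the outer valuation and the union over the
values of the bound variable share the index `i`, so together they form a single family over the
extended context. -/
theorem push_iUnion {τ : PureType} {ι : Type} (fp : ι → ∀ X, Set (Dom (Δ X))) (δ : ℕ → ℕ)
    (S : ι → Set (Dom τ)) :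
    push ⟨fun X => ⋃ i, fp i X, δ⟩ (⋃ i, S i) =
      ⟨fun Y => ⋃ i, (push (Δ := Δ) ⟨fp i, δ⟩ (S i)).fp Y, δ⟩ :=
  congrArg (FVal.mk · δ) (funext fun Y => Fin.cases rfl (fun _ => rfl) Y)

theorem push_iInter {τ : PureType} {ι : Type} (fp : ι → ∀ X, Set (Dom (Δ X))) (δ : ℕ → ℕ)
    (S : ι → Set (Dom τ)) :
    push ⟨fun X => ⋂ i, fp i X, δ⟩ (⋂ i, S i) =
      ⟨fun Y => ⋂ i, (push (Δ := Δ) ⟨fp i, δ⟩ (S i)).fp Y, δ⟩ :=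
  congrArg (FVal.mk · δ) (funext fun Y => Fin.cases rfl (fun _ => rfl) Y)

end FVal

-- Monotonicity of the interpretation.

namespace Form

/-- Two functions are allowed because the body of an iteration is compared at two different
valuations, or at two indices of a family. The hypothesis combines `f ≤ g` with monotonicity, which
is what the inductive step needs. -/
theorem iterate_subset_iterate {α : Type} {f g : Set α → Set α} {S T : Set α}
    (h : ∀ ⦃S T⦄, S ⊆ T → f S ⊆ g T) (hST : S ⊆ T) (m : ℕ) : f^[m] S ⊆ g^[m] T := by
  induction m with
  | zero => exact hST
  | succ m ih =>
    rw [Function.iterate_succ_apply', Function.iterate_succ_apply']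
    exact h ih

/-- The interpretation of formulae is monotone in the values of all fixpoint variables. -/
theorem eval_mono {n : ℕ} {Δ : FCtx n} {τ : PureType} (φ : Form Δ τ) {ρ ρ' : FVal Δ}
    (hfp : ρ.fp ≤ ρ'.fp) (hit : ρ.it = ρ'.it) : φ.eval ρ ⊆ φ.eval ρ' := by
  -- The types of `ρ` and `ρ'` depend on the context, an index of `Form`, so both valuations are
  -- generalized automatically and the induction hypotheses apply to pushed valuations.
  induction φ with
  | tt => exact subset_rfl
  | ff => exact subset_rfl
  | and φ ψ h1 h2 => exact Set.inter_subset_inter (h1 hfp hit) (h2 hfp hit)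
  | or φ ψ h1 h2 => exact Set.union_subset_union (h1 hfp hit) (h2 hfp hit)
  | triv => exact subset_rfl
  | fst φ ih => exact Set.preimage_mono (ih hfp hit)
  | snd φ ih => exact Set.preimage_mono (ih hfp hit)
  | inl φ ih => exact Set.image_mono (ih hfp hit)
  | inr φ ih => exact Set.image_mono (ih hfp hit)
  | fold φ ih => exact Set.preimage_mono (ih hfp hit)
  | var i h => subst h; exact hfp i
  | mu t φ ih =>
    simp only [eval, hit]
    exact iterate_subset_iterate (fun _ _ h => ih (FVal.push_fp_mono hfp h) hit) subset_rfl _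
  | nu t φ ih =>
    simp only [eval, hit]
    exact iterate_subset_iterate (fun _ _ h => ih (FVal.push_fp_mono hfp h) hit) subset_rfl _
  | ex φ ih =>
    exact Set.iUnion_mono fun m => ih hfp (by simp only [FVal.pushIt, hit])
  | all φ ih =>
    exact Set.iInter_mono fun m => ih hfp (by simp only [FVal.pushIt, hit])
  -- `FVal.closed` discards the fixpoint values, so the two sides coincide; in particular the
  -- contravariance in `ψ` plays no role.
  | imp ψ φ h1 h2 => simp only [eval, FVal.closed, hit]; exact subset_rfl

-- Directed unions and codirected intersections of valuations.

section Directed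

variable {ι : Type} [Preorder ι] [Nonempty ι]

/-- Iterates of a directed family of jointly continuous functions. -/
theorem iterate_iUnion {α : Type} {f : Set α → Set α} {g : ι → Set α → Set α}
    (hg : ∀ ⦃i j⦄, i ≤ j → ∀ ⦃S T⦄, S ⊆ T → g i S ⊆ g j T)
    (hf : ∀ S : ι → Set α, Monotone S → f (⋃ i, S i) = ⋃ i, g i (S i))
    (S : Set α) (m : ℕ) : f^[m] S = ⋃ i, (g i)^[m] S := by
  induction m with
  -- The starting set does not depend on `i`; nonemptiness of `ι` makes its union over `i` equal to
  -- itself.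
  | zero => exact (Set.iUnion_const S).symm
  | succ m ih =>
    simp only [Function.iterate_succ_apply', ih]
    -- The argument of `f` is now the union of the sets `(g i)^[m] S`, indexed by the same `i` as
    -- the functions. Continuity along the diagonal, as stated in `hf`, gives the next iterate
    -- directly.
    exact hf _ fun i j h => iterate_subset_iterate (hg h) subset_rfl m

/-- Iterates of a codirected family of jointly cocontinuous functions. -/
theorem iterate_iInter {α : Type} {f : Set α → Set α} {g : ι → Set α → Set α}
    (hg : ∀ ⦃i j⦄, i ≤ j → ∀ ⦃S T⦄, S ⊆ T → g j S ⊆ g i T)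
    (hf : ∀ S : ι → Set α, Antitone S → f (⋂ i, S i) = ⋂ i, g i (S i))
    (S : Set α) (m : ℕ) : f^[m] S = ⋂ i, (g i)^[m] S := by
  induction m with
  | zero => exact (Set.iInter_const S).symm
  | succ m ih =>
    simp only [Function.iterate_succ_apply', ih]
    exact hf _ fun i j h => iterate_subset_iterate (hg h) subset_rfl m

variable [IsDirectedOrder ι]

/-- The interpretation of positive formulae preserves directed unions, jointly in all fixpoint
variables. -/
theorem Lang.eval_iUnion {n : ℕ} {Δ : FCtx n} {τ : PureType} {s : Polarity} {φ : Form Δ τ}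
    (hφ : Lang s φ) (hs : s = .pos) {fp : ι → ∀ X, Set (Dom (Δ X))} (hfp : Monotone fp)
    (δ : ℕ → ℕ) :
    φ.eval ⟨fun X => ⋃ i, fp i X, δ⟩ = ⋃ i, φ.eval ⟨fp i, δ⟩ := by
  -- Needed for conjunction: a point lying in `φ` at one index and in `ψ` at another lies in both at
  -- a common upper bound, provided the two families increase.
  have key : ∀ {n : ℕ} {Δ : FCtx n} {τ : PureType} (φ : Form Δ τ)
      {fp : ι → ∀ X, Set (Dom (Δ X))} (δ : ℕ → ℕ), Monotone fp →
      Monotone fun i => φ.eval ⟨fp i, δ⟩ := fun φ _ _ h _ _ hij => φ.eval_mono (h hij) rfl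
  -- `δ` is generalized for `ex`, where the bound iteration variable receives a new value. The
  -- polarity is kept as a variable `s` with the equation `hs`, so that the induction has free
  -- indices.
  induction hφ generalizing δ with
  | tt => exact (Set.iUnion_const _).symm
  | ff => exact (Set.iUnion_const _).symm
  | and _ _ h1 h2 =>
    simp only [eval, h1 hs hfp, h2 hs hfp]
    exact (Set.iUnion_inter_of_monotone (key _ δ hfp) (key _ δ hfp)).symm
  | or _ _ h1 h2 =>
    simp only [eval, h1 hs hfp, h2 hs hfp]
    exact Set.iUnion_union_distrib _ _ |>.symm
  | triv => exact (Set.iUnion_const _).symm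
  | fst _ ih => simp only [eval, ih hs hfp]; exact Set.preimage_iUnion
  | snd _ ih => simp only [eval, ih hs hfp]; exact Set.preimage_iUnion
  | inl _ ih => simp only [eval, ih hs hfp]; exact Set.image_iUnion
  | inr _ ih => simp only [eval, ih hs hfp]; exact Set.image_iUnion
  | fold _ ih => simp only [eval, ih hs hfp]; exact Set.preimage_iUnion
  | var i h => subst h; rfl
  | mu t _ ih =>
    -- The iteration count is evaluated at `δ`, hence is the same number for all `i`. It remains to
    -- check joint continuity of the body in the outer valuation and the bound variable, which is
    -- the induction hypothesis over the extended context.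
    refine iterate_iUnion (g := fun i S => eval _ (FVal.push ⟨fp i, δ⟩ S))
      (fun i j hij S T h => eval_mono _ (FVal.push_mk_fp_mono δ (hfp hij) h) rfl) (fun S hS => ?_) _ _
    rw [FVal.push_iUnion]
    exact ih hs (fun i j hij => FVal.push_mk_fp_mono δ (hfp hij) (hS hij)) δ
  | nu t _ ih =>
    refine iterate_iUnion (g := fun i S => eval _ (FVal.push ⟨fp i, δ⟩ S))
      (fun i j hij S T h => eval_mono _ (FVal.push_mk_fp_mono δ (hfp hij) h) rfl) (fun S hS => ?_) _ _
    rw [FVal.push_iUnion]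
    exact ih hs (fun i j hij => FVal.push_mk_fp_mono δ (hfp hij) (hS hij)) δ
  -- The union over the values of the iteration variable is exchanged with the union over `i`.
  | ex _ _ ih => simp only [eval, FVal.pushIt, ih hs hfp]; exact Set.iUnion_comm _
  -- Membership of a universal formula forces the negative polarity, contradicting `hs`.
  | all => cases hs
  | imp => exact (Set.iUnion_const _).symm

/-- The interpretation of negative formulae preserves codirected intersections, jointly in all
fixpoint variables. -/
theorem Lang.eval_iInter {n : ℕ} {Δ : FCtx n} {τ : PureType} {s : Polarity} {φ : Form Δ τ}
    (hφ : Lang s φ) (hs : s = .neg) {fp : ι → ∀ X, Set (Dom (Δ X))} (hfp : Antitone fp)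
    (δ : ℕ → ℕ) :
    φ.eval ⟨fun X => ⋂ i, fp i X, δ⟩ = ⋂ i, φ.eval ⟨fp i, δ⟩ := by
  have key : ∀ {n : ℕ} {Δ : FCtx n} {τ : PureType} (φ : Form Δ τ)
      {fp : ι → ∀ X, Set (Dom (Δ X))} (δ : ℕ → ℕ), Antitone fp →
      Antitone fun i => φ.eval ⟨fp i, δ⟩ := fun φ _ _ h _ _ hij => φ.eval_mono (h hij) rfl
  induction hφ generalizing δ with
  | tt => exact (Set.iInter_const _).symm
  | ff => exact (Set.iInter_const _).symm
  | and _ _ h1 h2 =>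
    simp only [eval, h1 hs hfp, h2 hs hfp]
    exact Set.iInter_inter_distrib _ _ |>.symm
  | or _ _ h1 h2 =>
    simp only [eval, h1 hs hfp, h2 hs hfp]
    -- If a point misses `φ` at one index and `ψ` at another, it misses both at a common upper
    -- bound, because the families decrease.
    exact (Set.iInter_union_of_antitone (key _ δ hfp) (key _ δ hfp)).symm
  | triv => exact (Set.iInter_const _).symm
  | fst _ ih => simp only [eval, ih hs hfp]; exact Set.preimage_iInter
  | snd _ ih => simp only [eval, ih hs hfp]; exact Set.preimage_iInter
  | inl _ ih =>
    simp only [eval, ih hs hfp]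
    -- Direct images do not preserve intersections in general; here the inclusion into the sum is
    -- injective and the index type is nonempty.
    exact Set.InjOn.image_iInter_eq
      (fun _ _ _ _ h => Sum.inl_injective (WithBot.coe_injective h))
  | inr _ ih =>
    simp only [eval, ih hs hfp]
    exact Set.InjOn.image_iInter_eq
      (fun _ _ _ _ h => Sum.inr_injective (WithBot.coe_injective h))
  | fold _ ih => simp only [eval, ih hs hfp]; exact Set.preimage_iInter
  | var i h => subst h; rfl
  | mu t _ ih =>
    -- Starting a finite iteration from the empty set is harmless for intersections too: the initial
    -- set is constant in `i`, and each step preserves the intersection.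
    refine iterate_iInter (g := fun i S => eval _ (FVal.push ⟨fp i, δ⟩ S))
      (fun i j hij S T h => eval_mono _ (FVal.push_mk_fp_mono δ (hfp hij) h) rfl) (fun S hS => ?_) _ _
    rw [FVal.push_iInter]
    exact ih hs (fun i j hij => FVal.push_mk_fp_mono δ (hfp hij) (hS hij)) δ
  | nu t _ ih =>
    refine iterate_iInter (g := fun i S => eval _ (FVal.push ⟨fp i, δ⟩ S))
      (fun i j hij S T h => eval_mono _ (FVal.push_mk_fp_mono δ (hfp hij) h) rfl) (fun S hS => ?_) _ _
    rw [FVal.push_iInter]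
    exact ih hs (fun i j hij => FVal.push_mk_fp_mono δ (hfp hij) (hS hij)) δ
  | ex => cases hs
  | all _ _ ih => simp only [eval, FVal.pushIt, ih hs hfp]; exact Set.iInter_comm _
  | imp => exact (Set.iInter_const _).symm

end Directed

-- Specialization to a single fixpoint variable.

theorem evalFun_mono {n : ℕ} {Δ : FCtx n} {τ : PureType} (φ : Form Δ τ) (ρ : FVal Δ)
    (X : Fin n) : Monotone (φ.evalFun ρ X) :=
  fun _ _ h => φ.eval_mono (ρ.update_fp_mono X h) rfl

theorem Lang.scottContinuous_evalFun {n : ℕ} {Δ : FCtx n} {τ : PureType} {φ : Form Δ τ}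
    (hφ : Lang .pos φ) (ρ : FVal Δ) (X : Fin n) : ScottContinuous (φ.evalFun ρ X) := by
  intro d hne hd a ha
  have : Nonempty d := hne.to_subtype
  -- The directed set `d` serves as its own index type, ordered by inclusion, with the family being
  -- the identity.
  have : IsDirectedOrder d := directedOn_univ_iff.1 fun x _ y _ =>
    let ⟨z, hz, hxz, hyz⟩ := hd x x.2 y y.2
    ⟨⟨z, hz⟩, trivial, hxz, hyz⟩
  have h : φ.evalFun ρ X a = ⋃ S : d, φ.evalFun ρ X S := by
    rw [ha.unique (isLUB_sSup d), Set.sSup_eq_sUnion, Set.sUnion_eq_iUnion]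
    refine (congrArg φ.eval (ρ.update_iUnion X _)).trans ?_
    exact hφ.eval_iUnion (ι := d) rfl (fun _ _ h => ρ.update_fp_mono X h) ρ.it
  -- The indexed union is rewritten as the union of the image of `d`, which is its supremum in the
  -- powerset.
  rw [h, ← Set.sUnion_range, ← Set.image_eq_range]
  exact isLUB_sSup _

theorem Lang.scottCocontinuous_evalFun {n : ℕ} {Δ : FCtx n} {τ : PureType} {φ : Form Δ τ}
    (hφ : Lang .neg φ) (ρ : FVal Δ) (X : Fin n) : ScottCocontinuous (φ.evalFun ρ X) := by
  intro d hne hd a ha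
  have : Nonempty d := hne.to_subtype
  -- `Lang.eval_iInter` expects an antitone family over a directed order. Reversing the inclusion
  -- order on `d` makes a codirected set directed and the identity family antitone.
  have : IsDirectedOrder (↥d)ᵒᵈ := directedOn_univ_iff.1 fun x _ y _ =>
    let ⟨z, hz, hxz, hyz⟩ := hd _ (OrderDual.ofDual x).2 _ (OrderDual.ofDual y).2
    ⟨OrderDual.toDual ⟨z, hz⟩, trivial, hxz, hyz⟩
  have h : φ.evalFun ρ X a = ⋂ S : d, φ.evalFun ρ X S := by
    rw [ha.unique (isGLB_sInf d), Set.sInf_eq_sInter, Set.sInter_eq_iInter]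
    refine (congrArg φ.eval (ρ.update_iInter X _)).trans ?_
    exact hφ.eval_iInter (ι := (↥d)ᵒᵈ) rfl (fun _ _ h => ρ.update_fp_mono X h) ρ.it
  rw [h, ← Set.sInter_range, ← Set.image_eq_range]
  exact isGLB_sInf _

end Form

theorem mainTheorem9 {n : ℕ} (Δ : FCtx n) (τ : PureType) (φ : Form Δ τ) (ρ : FVal Δ) (X : Fin n) :
    (∀ s : Polarity, Form.Lang s φ → Monotone (φ.evalFun ρ X)) ∧
    (Form.Lang .pos φ → ScottContinuous (φ.evalFun ρ X)) ∧
    (Form.Lang .neg φ → ScottCocontinuous (φ.evalFun ρ X)) :=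
  ⟨fun _ _ => φ.evalFun_mono ρ X, fun h => h.scottContinuous_evalFun ρ X,
    fun h => h.scottCocontinuous_evalFun ρ X⟩
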